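/- All digraphs are finite and have no parallel edges. A \emph{source} (\emph{sink}) is a vertex without incoming (outgoing) edges. A digraph $H$ is \emph{equivalent to $D$ under source-sink identification} if it is obtained from $D$ by a finite sequence of identifications of two distinct vertices that are both sources or both sinks (parallel edges that arise are merged). Let $\Pi$ be a decision problem whose instances consist of a digraph $D$ and possibly a further datum $x$ (such as an integer) encoded by a bit string. $\Pi$ is \emph{source-sink-invariant} if, whenever $H$ is equivalent to $D$ under source-sink identification, $(D,x)$ is a yes-instance if and only if $(H,x)$ is, for every $x$. For $X\subseteq E(D)$ let $S_X$ be the set of vertices $y$ for which there are edges $\overrightarrow{xy}\in E(D)\setminus X$ and $\overrightarrow{yz}\in X$, and let $f_D(X)=|S_X\cup S_{E(D)\setminus X}|$. The \emph{directed branch-width} $\operatorname{dbw}(D)$ is the minimum, over all pairs $(T,\beta)$ of a finite tree $T$ of maximum degree at most three and a bijection $\beta$ from the leaves of $T$ to $E(D)$, of the maximum over the edges $e$ of $T$ of $f_D(\beta(Y_e))$, where $Y_e$ is the set of leaves in one of the two components of $T-e$ (and $\operatorname{dbw}(D)=0$ if $D$ has fewer than two edges). The \emph{underlying tree-width} of $D$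 is the tree-width $\operatorname{tw}(u(D))$ of its underlying undirected graph. For a width measure $\kappa$ of digraphs, $\Pi$ is in $\mathrm{FPT}$ \emph{parameterized by} $\kappa$ if there are an algorithm (a multi-tape Turing machine), a computable function $f:\mathbb N\to\mathbb N$ and a constant $c$ such that the algorithm decides every instance $I=(D,x)$ of $\Pi$ in time at most $f(\kappa(D))\cdot|I|^{c}$. \textbf{Theorem.} If $\Pi$ is a source-sink-invariant problem that is in $\mathrm{FPT}$ parameterized by underlying tree-width, then $\Pi$ is in $\mathrm{FPT}$ parameterized by directed branch-width. -/

import Mathlib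

namespace DirectedBranchWidth

/-! ### Digraphs, sources and sinks, identifications -/

/-- A finite digraph, with vertex set `Fin n` for some `n`. There are no parallel edges;
antiparallel edges (and loops) are allowed. -/
abbrev FinDigraph : Type := Σ n : ℕ, Digraph (Fin n)

/-- A source is a vertex with no incoming edge. -/
def IsSource {V : Type*} (D : Digraph V) (v : V) : Prop := ∀ u, ¬ D.Adj u v

/-- A sink is a vertex with no outgoing edge. -/
def IsSink {V : Type*} (D : Digraph V) (v : V) : Prop := ∀ w, ¬ D.Adj v w

/-- Two vertices are source/sink-identifiable if both are sources or both are sinks. -/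
def SourceSinkIdentifiable {V : Type*} (D : Digraph V) (x y : V) : Prop :=
  (IsSource D x ∧ IsSource D y) ∨ (IsSink D x ∧ IsSink D y)

/-- `H` is (a copy of) the digraph obtained from `D` by identifying the vertices `x` and `y`:
some surjection `φ` glues `x` to `y` and nothing else, and the edges of `H` are exactly the images
of the edges of `D`. -/
def IsIdentification {V W : Type*} (D : Digraph V) (x y : V) (H : Digraph W) : Prop :=
  ∃ φ : V → W, Function.Surjective φ ∧
    (∀ u v, φ u = φ v ↔ u = v ∨ (u = x ∧ v = y) ∨ (u = y ∧ v = x)) ∧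
    (∀ p q, H.Adj p q ↔ ∃ u v, φ u = p ∧ φ v = q ∧ D.Adj u v)

/-- `H` arises from `D` by identifying one pair of distinct source/sink-identifiable vertices. -/
def SourceSinkStep (D H : FinDigraph) : Prop :=
  ∃ x y : Fin D.1, x ≠ y ∧ SourceSinkIdentifiable D.2 x y ∧ IsIdentification D.2 x y H.2

/-- `H` is equivalent to `D` under source-sink identification: it is obtained from `D` by a
(possibly empty) sequence of identifications of pairs of source/sink-identifiable vertices. -/
def EquivalentUnderSourceSinkIdentification (D H : FinDigraph) : Prop :=
  Relation.ReflTransGen SourceSinkStep D H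

/-- A decision problem on digraphs. An instance is a digraph together with a further datum in `X`,
such as an integer; take `X = Unit` for problems whose instances are just digraphs. -/
abbrev DigraphProblem (X : Type*) := FinDigraph → X → Prop

/-- A problem is source-sink-invariant if digraphs that are equivalent under source-sink
identification have the same answer. -/
def SourceSinkInvariant {X : Type*} (P : DigraphProblem X) : Prop :=
  ∀ D H : FinDigraph, EquivalentUnderSourceSinkIdentification D H → ∀ x : X, P D x ↔ P H x

/-! ### Tree-width of the underlying undirected graph -/

/-- A tree decomposition of a graph `G`. -/
structure TreeDecomposition {V : Type*} (G : SimpleGraph V) where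
  /-- the number of nodes of the tree -/
  nodes : ℕ
  /-- the tree -/
  tree : SimpleGraph (Fin nodes)
  isTree : tree.IsTree
  /-- the bags -/
  bag : Fin nodes → Finset V
  vertex_mem : ∀ v, ∃ t, v ∈ bag t
  edge_mem : ∀ u v, G.Adj u v → ∃ t, u ∈ bag t ∧ v ∈ bag t
  connected : ∀ v, (tree.induce {t | v ∈ bag t}).Preconnected

/-- The tree-width of `G`: the least `w` such that some tree decomposition has all its bags of
size at most `w + 1`. -/
noncomputable def treeWidth {V : Type*} (G : SimpleGraph V) : ℕ :=
  sInf {w | ∃ T : TreeDecomposition G, ∀ t, (T.bag t).card ≤ w + 1}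

/-- The underlying tree-width `tw(u(D))` of a digraph. -/
noncomputable def underlyingTreeWidth (D : FinDigraph) : ℕ :=
  treeWidth D.2.toSimpleGraphInclusive

/-! ### Layouts and directed branch-width -/

/-- A layout on `U`: a finite tree of maximum degree at most three with a bijection from its
leaves (the vertices of degree one) to `U`. -/
structure Layout (U : Type*) where
  /-- the number of nodes of the tree -/
  nodes : ℕ
  /-- the tree -/
  tree : SimpleGraph (Fin nodes)
  isTree : tree.IsTree
  degree_le : ∀ t, (tree.neighborSet t).ncard ≤ 3
  /-- the bijection from the leaves to `U` -/
  leafEquiv : {t : Fin nodes // (tree.neighborSet t).ncard = 1} ≃ U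

/-- For a tree edge `st`, the elements of `U` that sit at the leaves in the component of
`T - st` containing `t`. -/
def Layout.side {U : Type*} (L : Layout U) (s t : Fin L.nodes) : Set U :=
  {e | (L.tree.deleteEdges {s(s, t)}).Reachable t (L.leafEquiv.symm e)}

/-- The layout-`f`-width of `U`: the least `k` such that in some layout all tree edges have order
at most `k`. It is `0` if `U` has fewer than two elements (there is no layout if `U` has exactly
one element). -/
noncomputable def layoutWidth {U : Type*} (f : Set U → ℕ) : ℕ :=
  sInf {k | ∃ L : Layout U, ∀ s t, L.tree.Adj s t → f (L.side s t) ≤ k}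

/-- The edge set of a digraph, as a type. -/
abbrev Edge {V : Type*} (D : Digraph V) : Type _ := {e : V × V // D.Adj e.1 e.2}

/-- The directed vertex separator of the edge partition `(E(D) \ B, B)`: the vertices `y` that are
the head of an edge outside `B` and the tail of an edge in `B`. -/
def vertexSeparator {V : Type*} (D : Digraph V) (B : Set (Edge D)) : Set V :=
  {y | ∃ e f : Edge D, e ∉ B ∧ f ∈ B ∧ e.1.2 = y ∧ f.1.1 = y}

/-- The directed branch-width of a digraph: the layout-`f`-width of its edge set for the function
`f` sending `B` to the number of vertices in the union of the two directed separators of `B`. -/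
noncomputable def directedBranchWidth (D : FinDigraph) : ℕ :=
  layoutWidth fun B : Set (Edge D.2) => (vertexSeparator D.2 B ∪ vertexSeparator D.2 Bᶜ).ncard

/-! ### Instances as words, fixed-parameter tractability -/

/-- The input alphabet. -/
inductive Sym : Type
  | tick
  | sep
  | endGraph
  | bit (b : Bool)

/-- An instance as given to an algorithm: the number of vertices, the edges listed in an arbitrary
order without repetition, and the further datum. -/
structure Instance (X : Type*) where
  n : ℕ
  edges : List (Fin n × Fin n)
  nodup : edges.Nodup
  extra : X

/-- The digraph described by an instance. -/
def Instance.digraph {X : Type*} (I : Instance X) : FinDigraph :=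
  ⟨I.n, ⟨fun u v => (u, v) ∈ I.edges⟩⟩

/-- The number `a` in unary, closed by a separator. -/
def encodeNat (a : ℕ) : List Sym := List.replicate a Sym.tick ++ [Sym.sep]

/-- The input word of an instance: the number of vertices, then the tail and the head of each
edge, then an end marker, then the bits of the further datum. The length of this word is
polynomially related to the number of vertices plus the number of bits. -/
def Instance.encode {X : Type*} (bits : X → List Bool) (I : Instance X) : List Sym :=
  encodeNat I.n ++ I.edges.flatMap (fun e => encodeNat e.1 ++ encodeNat e.2) ++
    [Sym.endGraph] ++ (bits I.extra).map Sym.bit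

/-- The decision problem with instances `I : ι`, given as words `enc I` over `Γ`, yes-instances
`yes` and parameter `κ` is fixed-parameter tractable: there are a Turing machine, a computable
function `f` and a constant `c` such that the machine, on every instance `I`, halts with the
correct answer after at most `f (κ I) * |I| ^ c` steps. -/
def FixedParameterTractable {ι : Type*} {Γ : Type} (enc : ι → List Γ) (yes : ι → Prop)
    (κ : ι → ℕ) : Prop :=
  ∃ (M : Turing.TM2ComputableAux Γ Bool) (f : ℕ → ℕ) (c : ℕ), Computable f ∧
    ∀ I : ι, ∃ answer : Bool, (answer = true ↔ yes I) ∧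
      Nonempty (Turing.TM2OutputsInTime M.tm ((enc I).map M.inputAlphabet.symm)
        (some ([answer].map M.outputAlphabet.symm)) (f (κ I) * (enc I).length ^ c))

/-- The problem `P` is fixed-parameter tractable parameterized by the digraph width measure
`width`; `bits` says how the further data are written in binary. -/
def FPTParameterizedBy {X : Type*} (bits : X → List Bool) (P : DigraphProblem X)
    (width : FinDigraph → ℕ) : Prop :=
  FixedParameterTractable (fun I : Instance X => I.encode bits) (fun I => P I.digraph I.extra)
    (fun I => width I.digraph)

end DirectedBranchWidth

namespace DirectedBranchWidth

open Turing

/-! ### Runs of bounded length -/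

/-! Give every edge that leaves a source its own tail and every edge that enters a sink its own
head; the replaced vertices stay behind, isolated. Let H be the result of doing this to D.

Gluing the copies back identifies only sources with sources and sinks with sinks, so D is equivalent
to H under source-sink identification and the invariant problem has the same answer on both
(`equivalent_of_quotient`, `IsSplitting.iff`).

Moreover tw(u(H)) ≤ 3 dbw(D) + 1. A vertex of H on two different edges has both an incoming and an
outgoing edge. If its edges occur on both sides of a cut of a layout of E(D), then some incoming and
some outgoing edge lie on different sides, so its image is counted by the directed separators. The
projection to D is injective on such vertices. Thus every tree edge is crossed by at most dbw(D)
vertices of H, and a branch decomposition turns into a tree decomposition in the classical way: a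
node takes the vertices having two edges (possibly equal) whose connecting path passes through it. A
bag has at most two vertices from an edge placed at the node and dbw(D) from each of at most three
tree edges (`treeWidth_le_of_placement`, `treeWidth_le_directedBranchWidth`).

It remains to compute H in polynomial time and then run the given machine on it. A stack machine
does this explicitly: it determines the sources and sinks one vertex at a time by counting off unary
digits, in quadratic time overall (`run_split`), and then simulates the given machine step by step
(`splitComputableAux_outputs`). The new word is at most cubically longer. Since the given `f` need
not be monotone, it is replaced by a partial sum. -/

/-- The partial function `f` leads from `a` to `b` in at most `n` steps. -/
def ReachesIn {α : Type*} (f : α → Option α) (n : ℕ) (a b : α) : Prop :=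
  Nonempty (StateTransition.EvalsToInTime f a (some b) n)

namespace ReachesIn

variable {α : Type*} {f : α → Option α} {m n : ℕ} {a b c : α}

theorem refl (n : ℕ) (a : α) : ReachesIn f n a a :=
  ⟨⟨⟨0, rfl⟩, n.zero_le⟩⟩

theorem mono (h : ReachesIn f m a b) (hmn : m ≤ n) : ReachesIn f n a b :=
  h.elim fun h => ⟨⟨h.toEvalsTo, h.steps_le_m.trans hmn⟩⟩

theorem trans (h : ReachesIn f m a b) (h' : ReachesIn f n b c) : ReachesIn f (m + n) a c :=
  h.elim fun h => h'.elim fun h' => ⟨by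
    rw [Nat.add_comm]; exact StateTransition.EvalsToInTime.trans f _ _ _ _ _ h h'⟩

theorem step (h : f a = some b) (h' : ReachesIn f n b c) : ReachesIn f (n + 1) a c := by
  have : ReachesIn f 1 a b := ⟨⟨⟨1, by simpa [flip] using h⟩, le_rfl⟩⟩
  exact (this.trans h').mono (by omega)

theorem congr {a' b' : α} (h : ReachesIn f n a b) (ha : a = a') (hb : b = b') :
    ReachesIn f n a' b' := by
  rwa [← ha, ← hb]

end ReachesIn

/-! ### The machine -/

/-- What is known about an endpoint of an edge: not yet compared with the current vertex, equal to
the current vertex, or dealt with; in the last case it is recorded whether the endpoint has to be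
replaced by a fresh vertex. -/
inductive Status : Type
  | pending
  | hit
  | done (split : Bool)
  deriving DecidableEq, Fintype

/-- The alphabet of the stacks that hold the edges: a unary digit, either counted or not, and the
end mark of a number, which is the head or the tail of an edge. -/
inductive WorkSym : Type
  | tick (counted : Bool)
  | mark (head : Bool) (status : Status)
  deriving DecidableEq, Fintype

instance : Fintype Sym :=
  ⟨⟨{.tick, .sep, .endGraph, .bit true, .bit false}, by simp⟩, by rintro (_ | _ | _ | _ | _) <;> simp⟩

/-- The additional stacks of the machine. -/
inductive WorkStack : Type
  | input
  | aux
  | rounds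
  | fresh
  | front
  | back
  deriving DecidableEq

instance : Fintype WorkStack :=
  ⟨{.input, .aux, .rounds, .fresh, .front, .back}, by rintro (_ | _) <;> simp⟩

/-- The additional labels of the machine. -/
inductive Phase : Type
  | readOrder
  | readEdges
  | readExtra
  | writeExtra
  | toFront
  | round
  | detect
  | update
  | toBack
  | writeEdges
  | writeFresh
  | restoreFresh
  | writeOrder
  deriving DecidableEq

instance : Fintype Phase :=
  ⟨{.readOrder, .readEdges, .readExtra, .writeExtra, .toFront, .round, .detect, .update, .toBack,
    .writeEdges, .writeFresh, .restoreFresh, .writeOrder}, by rintro (_ | _) <;> simp⟩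

/-- The additional registers of the machine. -/
structure Reg : Type where
  sym : Option Sym := none
  work : Option WorkSym := none
  flag : Bool := false
  seenTail : Bool := false
  seenHead : Bool := false
  deriving Fintype

section Machine

open TM2.Stmt

variable (M : FinTM2) (e : M.Γ M.k₀ ≃ Sym)

/-- The alphabets of the stacks of the machine that first splits the sources and sinks and then
runs `M`. -/
abbrev Alphabet : M.K ⊕ WorkStack → Type
  | .inl k => M.Γ k
  | .inr .input => Sym
  | .inr .aux => Sym
  | .inr .rounds => Sym
  | .inr .fresh => Sym
  | .inr .front => WorkSym
  | .inr .back => WorkSym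

/-- The statements of the machine that first splits the sources and sinks and then runs `M`. -/
abbrev SplitStmt : Type := TM2.Stmt (Alphabet M) (M.Λ ⊕ Phase) (M.σ × Reg)

variable {M} in
/-- A statement of `M` as a statement of the larger machine. -/
def liftStmt : TM2.Stmt M.Γ M.Λ M.σ → SplitStmt M
  | push k f q => push (.inl k) (fun s => f s.1) (liftStmt q)
  | peek k f q => peek (.inl k) (fun s x => (f s.1 x, s.2)) (liftStmt q)
  | pop k f q => pop (.inl k) (fun s x => (f s.1 x, s.2)) (liftStmt q)
  | load f q => load (fun s => (f s.1, s.2)) (liftStmt q)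
  | branch p q q' => branch (fun s => p s.1) (liftStmt q) (liftStmt q')
  | goto l => goto fun s => .inl (l s.1)
  | halt => halt

/-- Change the additional registers. -/
def setReg (f : Reg → Reg) (q : SplitStmt M) : SplitStmt M :=
  load (fun s => (s.1, f s.2)) q

/-- Branch according to the additional registers. -/
def ifReg (p : Reg → Bool) (q q' : SplitStmt M) : SplitStmt M :=
  branch (fun s => p s.2) q q'

/-- Go to another phase. -/
def gotoPhase (l : Phase) : SplitStmt M :=
  goto fun _ => .inr l

/-- Write a symbol of the new instance. -/
def write (f : Reg → Sym) (q : SplitStmt M) : SplitStmt M :=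
  push (.inl M.k₀) (fun s => e.symm (f s.2)) q

/-- Read a symbol into a register. -/
def readSym (j : WorkStack) (h : Alphabet M (.inr j) = Sym) (q : SplitStmt M) : SplitStmt M :=
  pop (.inr j) (fun s x => (s.1, { s.2 with sym := x.map (cast h) })) q

/-- Push a tick. -/
def pushTick (j : WorkStack) (h : Alphabet M (.inr j) = Sym) (q : SplitStmt M) : SplitStmt M :=
  push (.inr j) (fun _ => cast h.symm .tick) q

/-- Read a symbol of an edge word into a register. -/
def readWork (j : WorkStack) (h : Alphabet M (.inr j) = WorkSym) (q : SplitStmt M) : SplitStmt M :=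
  pop (.inr j) (fun s x => (s.1, { s.2 with work := x.map (cast h) })) q

/-- Push a symbol of an edge word. -/
def pushWork (j : WorkStack) (h : Alphabet M (.inr j) = WorkSym) (f : Reg → WorkSym)
    (q : SplitStmt M) : SplitStmt M :=
  push (.inr j) (fun s => cast h.symm (f s.2)) q

/-- The symbol in the work register. -/
def Reg.current (r : Reg) : WorkSym := r.work.getD (.tick false)

/-- In the detection pass, a pending number without uncounted digits is the current vertex; here
`flag` says whether the number had an uncounted digit. -/
def detectSym (flag : Bool) : WorkSym → WorkSym
  | .mark h .pending => .mark h (if flag then .pending else .hit)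
  | w => w

/-- The registers after one step of the detection pass. -/
def detectReg (r : Reg) : Reg :=
  match r.current with
  | .tick b => { r with flag := r.flag || !b }
  | .mark false .pending => { r with flag := false, seenTail := r.seenTail || !r.flag }
  | .mark true .pending => { r with flag := false, seenHead := r.seenHead || !r.flag }
  | .mark _ _ => { r with flag := false }

/-- In the update pass, one digit of each pending number is counted; here `flag` says whether this
is still to be done. The current vertex is a source if it was not seen as a head, and a sink if it
was not seen as a tail. -/
def updateSym (r : Reg) : WorkSym → WorkSym
  | .tick b => .tick (b || r.flag)
  | .mark h .hit => .mark h (.done !(if h then r.seenTail else r.seenHead))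
  | .mark h st => .mark h st

/-- The registers after one step of the update pass. -/
def updateReg (r : Reg) : Reg :=
  match r.current with
  | .tick b => { r with flag := r.flag && b }
  | .mark _ .pending => { r with flag := true }
  | .mark _ _ => { r with flag := false }

/-- The program of the machine that first splits the sources and sinks and then runs `M`. -/
def splitProgram : M.Λ ⊕ Phase → SplitStmt M
  | .inl l => liftStmt (M.m l)
  | .inr .readOrder =>
    readSym M .input rfl <| ifReg M (fun r => r.sym matches some .tick)
      (pushTick M .rounds rfl <| pushTick M .fresh rfl <| gotoPhase M .readOrder)
      (gotoPhase M .readEdges)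
  | .inr .readEdges =>
    readSym M .input rfl <| ifReg M (fun r => r.sym matches some .tick)
      (pushWork M .back rfl (fun _ => .tick false) <| gotoPhase M .readEdges) <|
      ifReg M (fun r => r.sym matches some .sep)
        (pushWork M .back rfl (fun r => .mark r.flag .pending) <|
          setReg M (fun r => { r with flag := !r.flag }) <| gotoPhase M .readEdges)
        (gotoPhase M .readExtra)
  | .inr .readExtra =>
    readSym M .input rfl <| ifReg M (fun r => r.sym.isSome)
      (push (.inr .aux) (fun s => s.2.sym.getD .tick) <| gotoPhase M .readExtra)
      (gotoPhase M .writeExtra)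
  | .inr .writeExtra =>
    readSym M .aux rfl <| ifReg M (fun r => r.sym.isSome)
      (write M e (fun r => r.sym.getD .tick) <| gotoPhase M .writeExtra)
      (write M e (fun _ => .endGraph) <| gotoPhase M .toFront)
  | .inr .toFront =>
    readWork M .back rfl <| ifReg M (fun r => r.work.isSome)
      (pushWork M .front rfl Reg.current <| gotoPhase M .toFront)
      (gotoPhase M .round)
  | .inr .round =>
    -- All other registers are cleared, so that each round starts with the current vertex seen
    -- neither as a tail nor as a head.
    readSym M .rounds rfl <| setReg M (fun r => { sym := r.sym }) <|
      ifReg M (fun r => r.sym.isSome) (gotoPhase M .detect) (gotoPhase M .toBack)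
  | .inr .detect =>
    readWork M .front rfl <| ifReg M (fun r => r.work.isSome)
      (pushWork M .back rfl (fun r => detectSym r.flag r.current) <|
        setReg M detectReg <| gotoPhase M .detect)
      (gotoPhase M .update)
  | .inr .update =>
    readWork M .back rfl <| ifReg M (fun r => r.work.isSome)
      (pushWork M .front rfl (fun r => updateSym r r.current) <|
        setReg M updateReg <| gotoPhase M .update)
      (gotoPhase M .round)
  | .inr .toBack =>
    readWork M .front rfl <| ifReg M (fun r => r.work.isSome)
      (pushWork M .back rfl Reg.current <| gotoPhase M .toBack)
      (gotoPhase M .writeEdges)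
  | .inr .writeEdges =>
    readWork M .back rfl <| ifReg M (fun r => r.work.isSome)
      (ifReg M (fun r => r.current matches .tick _)
        (ifReg M (fun r => r.flag)
          (write M e (fun _ => .tick) <| gotoPhase M .writeEdges)
          (gotoPhase M .writeEdges))
        (write M e (fun _ => .sep) <|
          -- The word is written from its end, so the closing separator comes before the digits.
          -- From here on `flag` tells whether the old digits are copied or dropped.
          ifReg M (fun r => r.current matches .mark _ (.done true))
            (setReg M (fun r => { r with flag := false }) <| gotoPhase M .writeFresh)
            (setReg M (fun r => { r with flag := true }) <| gotoPhase M .writeEdges)))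
      (write M e (fun _ => .sep) <| gotoPhase M .writeOrder)
  | .inr .writeFresh =>
    readSym M .fresh rfl <| ifReg M (fun r => r.sym.isSome)
      (pushTick M .aux rfl <| write M e (fun _ => .tick) <| gotoPhase M .writeFresh)
      -- This extra tick increments the counter of fresh vertices.
      (pushTick M .fresh rfl <| gotoPhase M .restoreFresh)
  | .inr .restoreFresh =>
    readSym M .aux rfl <| ifReg M (fun r => r.sym.isSome)
      (pushTick M .fresh rfl <| gotoPhase M .restoreFresh)
      (gotoPhase M .writeEdges)
  | .inr .writeOrder =>
    readSym M .fresh rfl <| ifReg M (fun r => r.sym.isSome)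
      (write M e (fun _ => .tick) <| gotoPhase M .writeOrder)
      -- `embedCfg` requires cleared registers.
      (setReg M (fun _ => {}) <| goto fun _ => .inl M.main)

/-- The machine that first splits the sources and sinks and then runs `M`. -/
def splitMachine : FinTM2 where
  K := M.K ⊕ WorkStack
  kDecidableEq := inferInstance
  kFin := letI := M.kFin; inferInstance
  k₀ := .inr .input
  k₁ := .inl M.k₁
  Γ := Alphabet M
  Λ := M.Λ ⊕ Phase
  main := .inr .readOrder
  ΛFin := letI := M.ΛFin; inferInstance
  σ := M.σ × Reg
  initialState := (M.initialState, {})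
  σFin := letI := M.σFin; inferInstance
  Γk₀Fin := inferInstanceAs (Fintype Sym)
  m := splitProgram M e

/-- The contents of the stacks while the new instance is being written. -/
def contents (out : List (M.Γ M.k₀)) (input aux rounds fresh : List Sym) (front back : List WorkSym) :
    ∀ k, List (Alphabet M k)
  -- Until `M` starts, its input stack is the only one of its stacks in use.
  | .inl k => Function.update (fun _ => []) M.k₀ out k
  | .inr .input => input
  | .inr .aux => aux
  | .inr .rounds => rounds
  | .inr .fresh => fresh
  | .inr .front => front
  | .inr .back => back

section Stacks

variable (out : List (M.Γ M.k₀)) (i a r c x : List Sym) (f b y : List WorkSym)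

@[simp] theorem contents_k₀ : contents M out i a r c f b (.inl M.k₀) = out := by simp [contents]
@[simp] theorem contents_input : contents M out i a r c f b (.inr .input) = i := rfl
@[simp] theorem contents_aux : contents M out i a r c f b (.inr .aux) = a := rfl
@[simp] theorem contents_rounds : contents M out i a r c f b (.inr .rounds) = r := rfl
@[simp] theorem contents_fresh : contents M out i a r c f b (.inr .fresh) = c := rfl
@[simp] theorem contents_front : contents M out i a r c f b (.inr .front) = f := rfl
@[simp] theorem contents_back : contents M out i a r c f b (.inr .back) = b := rfl

@[simp] theorem update_contents_k₀ (o : List (M.Γ M.k₀)) :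
    Function.update (contents M out i a r c f b) (.inl M.k₀) o = contents M o i a r c f b := by
  funext k
  rcases k with k | k
  · rcases eq_or_ne k M.k₀ with rfl | hk
    · simp
    · rw [Function.update_of_ne (by simpa using hk)]
      simp [contents, Function.update_of_ne hk]
  · rw [Function.update_of_ne (by simp)]; cases k <;> rfl

@[simp] theorem update_contents_input :
    Function.update (contents M out i a r c f b) (.inr .input) x = contents M out x a r c f b := by
  funext k; rcases k with k | (_ | _) <;> rfl
@[simp] theorem update_contents_aux :
    Function.update (contents M out i a r c f b) (.inr .aux) x = contents M out i x r c f b := by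
  funext k; rcases k with k | (_ | _) <;> rfl
@[simp] theorem update_contents_rounds :
    Function.update (contents M out i a r c f b) (.inr .rounds) x = contents M out i a x c f b := by
  funext k; rcases k with k | (_ | _) <;> rfl
@[simp] theorem update_contents_fresh :
    Function.update (contents M out i a r c f b) (.inr .fresh) x = contents M out i a r x f b := by
  funext k; rcases k with k | (_ | _) <;> rfl
@[simp] theorem update_contents_front :
    Function.update (contents M out i a r c f b) (.inr .front) y = contents M out i a r c y b := by
  funext k; rcases k with k | (_ | _) <;> rfl
@[simp] theorem update_contents_back :
    Function.update (contents M out i a r c f b) (.inr .back) y = contents M out i a r c f y := by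
  funext k; rcases k with k | (_ | _) <;> rfl

end Stacks

/-- The configurations of the machine. -/
abbrev SplitCfg : Type := TM2.Cfg (Alphabet M) (M.Λ ⊕ Phase) (M.σ × Reg)

/-- The configuration of the machine in a given phase. -/
def config (l : Phase) (v : Reg) (out : List (M.Γ M.k₀)) (input aux rounds fresh : List Sym)
    (front back : List WorkSym) : SplitCfg M :=
  ⟨some (.inr l), (M.initialState, v), contents M out input aux rounds fresh front back⟩

/-- `ReachesIn` for the machine. -/
abbrev Run (n : ℕ) (a b : SplitCfg M) : Prop :=
  ReachesIn (TM2.step (splitProgram M e)) n a b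

variable {M e} in
/-- Execute one step of the machine. -/
theorem run_step {n : ℕ} {l : Phase} {v : Reg} {out : List (M.Γ M.k₀)} {i a r c : List Sym}
    {f b : List WorkSym} {x y : SplitCfg M}
    (h : TM2.stepAux (splitProgram M e (.inr l)) (M.initialState, v) (contents M out i a r c f b) = x)
    (h' : Run M e n x y) : Run M e (n + 1) (config M l v out i a r c f b) y :=
  ReachesIn.step (congrArg some h) h'

end Machine

/-! ### Edge words -/

/-- A number with `r` of its digits counted. -/
def number (r : ℕ) (h : Bool) (a : ℕ) (st : Status) : List WorkSym :=
  -- Uncounted digits come first: read backwards from the mark, the first uncounted digit borders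
  -- the counted ones, and counting it preserves this shape.
  List.replicate (a - r) (.tick false) ++ (List.replicate (min a r) (.tick true) ++ [.mark h st])

/-- The edges, with `r` of the digits of each number counted. -/
def edgeWord (r : ℕ) (st : Bool → ℕ → Status) (E : List (ℕ × ℕ)) : List WorkSym :=
  E.flatMap fun e => number r false e.1 (st false e.1) ++ number r true e.2 (st true e.2)

/-- The edges of an instance as they are given to a machine. -/
def encodeEdges (E : List (ℕ × ℕ)) : List Sym :=
  E.flatMap fun e => encodeNat e.1 ++ encodeNat e.2

/-- The status of the endpoints after `r` rounds. -/
def statusAfter (split : Bool → ℕ → Bool) (r : ℕ) (h : Bool) (a : ℕ) : Status :=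
  if a < r then .done (split h a) else .pending

/-- The status of the endpoints after the detection pass of round `r`. -/
def statusDetected (split : Bool → ℕ → Bool) (r : ℕ) (h : Bool) (a : ℕ) : Status :=
  if a < r then .done (split h a) else if a = r then .hit else .pending

@[simp] theorem edgeWord_nil (r : ℕ) (st : Bool → ℕ → Status) : edgeWord r st [] = [] := rfl

@[simp] theorem edgeWord_cons (r : ℕ) (st : Bool → ℕ → Status) (x : ℕ × ℕ) (E : List (ℕ × ℕ)) :
    edgeWord r st (x :: E) =
      number r false x.1 (st false x.1) ++ (number r true x.2 (st true x.2) ++ edgeWord r st E) := by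
  simp [edgeWord]

@[simp] theorem encodeEdges_nil : encodeEdges [] = [] := rfl

@[simp] theorem encodeEdges_cons (x : ℕ × ℕ) (E : List (ℕ × ℕ)) :
    encodeEdges (x :: E) = encodeNat x.1 ++ (encodeNat x.2 ++ encodeEdges E) := by
  simp [encodeEdges]

@[simp] theorem length_encodeNat (a : ℕ) : (encodeNat a).length = a + 1 := by simp [encodeNat]

@[simp] theorem length_number (r : ℕ) (h : Bool) (a : ℕ) (st : Status) :
    (number r h a st).length = a + 1 := by
  simp [number]; omega

theorem length_edgeWord (r : ℕ) (st : Bool → ℕ → Status) (E : List (ℕ × ℕ)) :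
    (edgeWord r st E).length = (encodeEdges E).length := by
  induction E with
  | nil => rfl
  | cons x E ih => simp [ih]

theorem replicate_append_cons {α : Type*} (n : ℕ) (a : α) (l : List α) :
    List.replicate n a ++ a :: l = List.replicate (n + 1) a ++ l := by
  rw [List.replicate_succ', List.append_assoc]; rfl

/-! ### Runs of the machine: reading the input -/

section Machine

variable (M : FinTM2) (e : M.Γ M.k₀ ≃ Sym)

variable (out : List (M.Γ M.k₀)) (i a r c : List Sym) (f b : List WorkSym)

attribute [local simp] splitProgram readSym readWork pushTick pushWork write ifReg setReg gotoPhase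
  Reg.current

theorem run_readOrder (n : ℕ) (v : Reg) (w : List Sym) (r c : List Sym) :
    ∃ v' : Reg, v'.flag = v.flag ∧
      Run M e (n + 1) (config M .readOrder v out (encodeNat n ++ w) a r c f b)
        (config M .readEdges v' out w a (List.replicate n .tick ++ r)
          (List.replicate n .tick ++ c) f b) := by
  induction n generalizing v r c with
  | zero =>
    refine ⟨{ v with sym := some .sep }, rfl, run_step ?_ (.refl 0 _)⟩
    simp [encodeNat, config]
  | succ n ih =>
    obtain ⟨v', hv, h⟩ := ih { v with sym := some .tick } (.tick :: r) (.tick :: c)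
    refine ⟨v', hv, ?_⟩
    rw [← replicate_append_cons, ← replicate_append_cons]
    exact run_step (by simp [encodeNat, config, List.replicate_succ]) h

theorem run_readNumber (n : ℕ) (v : Reg) (w : List Sym) (b : List WorkSym) :
    ∃ v' : Reg, v'.flag = !v.flag ∧
      Run M e (n + 1) (config M .readEdges v out (encodeNat n ++ w) a r c f b)
        (config M .readEdges v' out w a r c f
          (.mark v.flag .pending :: (List.replicate n (.tick false) ++ b))) := by
  induction n generalizing v b with
  | zero =>
    refine ⟨{ v with sym := some .sep, flag := !v.flag }, rfl, run_step ?_ (.refl 0 _)⟩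
    simp [encodeNat, config]
  | succ n ih =>
    obtain ⟨v', hv, h⟩ := ih { v with sym := some .tick } (.tick false :: b)
    refine ⟨v', hv, ?_⟩
    rw [← replicate_append_cons]
    exact run_step (by simp [encodeNat, config, List.replicate_succ]) h

theorem run_readEdges (E : List (ℕ × ℕ)) (v : Reg) (hv : v.flag = false) (w : List Sym)
    (b : List WorkSym) :
    ∃ v' : Reg, Run M e ((encodeEdges E).length + 1)
      (config M .readEdges v out (encodeEdges E ++ .endGraph :: w) a r c f b)
      (config M .readExtra v' out w a r c f
        ((edgeWord 0 (fun _ _ => .pending) E).reverse ++ b)) := by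
  induction E generalizing v b with
  | nil =>
    refine ⟨{ v with sym := some .endGraph }, run_step ?_ (.refl 0 _)⟩
    simp [config]
  | cons x E ih =>
    rw [encodeEdges_cons, List.append_assoc, List.append_assoc]
    obtain ⟨v₁, hv₁, h₁⟩ := run_readNumber M e out a r c f x.1 v
      (encodeNat x.2 ++ (encodeEdges E ++ .endGraph :: w)) b
    obtain ⟨v₂, hv₂, h₂⟩ := run_readNumber M e out a r c f x.2 v₁
      (encodeEdges E ++ .endGraph :: w)
      (.mark v.flag .pending :: (List.replicate x.1 (.tick false) ++ b))
    obtain ⟨v₃, h₃⟩ := ih v₂ (by simp [hv₂, hv₁, hv])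
      (.mark v₁.flag .pending :: (List.replicate x.2 (.tick false) ++
        (.mark v.flag .pending :: (List.replicate x.1 (.tick false) ++ b))))
    refine ⟨v₃, ?_⟩
    convert (h₁.trans h₂).trans h₃ using 1
    · simp; omega
    · simp [number, hv₁, hv]

theorem run_readExtra (w a : List Sym) (v : Reg) :
    ∃ v' : Reg, Run M e (w.length + 1) (config M .readExtra v out w a r c f b)
      (config M .writeExtra v' out [] (w.reverse ++ a) r c f b) := by
  induction w generalizing v a with
  | nil =>
    refine ⟨{ v with sym := none }, run_step ?_ (.refl 0 _)⟩
    simp [config]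
  | cons x w ih =>
    obtain ⟨v', h⟩ := ih (x :: a) { v with sym := some x }
    refine ⟨v', ?_⟩
    rw [List.reverse_cons, List.append_assoc]
    exact run_step (by simp [config]) h

theorem run_writeExtra (w : List Sym) (v : Reg) (out : List (M.Γ M.k₀)) :
    ∃ v' : Reg, Run M e (w.length + 1) (config M .writeExtra v out i w r c f b)
      (config M .toFront v' (e.symm .endGraph :: (w.reverse.map e.symm ++ out)) i [] r c f b) := by
  induction w generalizing v out with
  | nil =>
    refine ⟨{ v with sym := none }, run_step ?_ (.refl 0 _)⟩
    simp [config]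
  | cons x w ih =>
    obtain ⟨v', h⟩ := ih { v with sym := some x } (e.symm x :: out)
    refine ⟨v', ?_⟩
    rw [List.reverse_cons, List.map_append, List.append_assoc]
    exact run_step (by simp [config]) h

theorem run_toFront (w f : List WorkSym) (v : Reg) :
    ∃ v' : Reg, Run M e (w.length + 1) (config M .toFront v out i a r c f w)
      (config M .round v' out i a r c (w.reverse ++ f) []) := by
  induction w generalizing v f with
  | nil =>
    refine ⟨{ v with work := none }, run_step ?_ (.refl 0 _)⟩
    simp [config]
  | cons x w ih =>
    obtain ⟨v', h⟩ := ih (x :: f) { v with work := some x }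
    refine ⟨v', ?_⟩
    rw [List.reverse_cons, List.append_assoc]
    exact run_step (by simp [config]) h

theorem run_toBack (w b : List WorkSym) (v : Reg) (hv : v.flag = false) :
    ∃ v' : Reg, v'.flag = false ∧ Run M e (w.length + 1) (config M .toBack v out i a r c w b)
      (config M .writeEdges v' out i a r c [] (w.reverse ++ b)) := by
  induction w generalizing v b with
  | nil =>
    refine ⟨{ v with work := none }, hv, run_step ?_ (.refl 0 _)⟩
    simp [config]
  | cons x w ih =>
    obtain ⟨v', hv', h⟩ := ih (x :: b) { v with work := some x } hv
    refine ⟨v', hv', ?_⟩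
    rw [List.reverse_cons, List.append_assoc]
    exact run_step (by simp [config]) h

/-! #### Detection -/

/-- One step of the detection pass. -/
theorem run_detect_cons (x : WorkSym) (v : Reg) {n : ℕ} {y : SplitCfg M}
    (h : Run M e n (config M .detect (detectReg { v with work := some x }) out i a r c f
      (detectSym v.flag x :: b)) y) :
    Run M e (n + 1) (config M .detect v out i a r c (x :: f) b) y := by
  refine run_step ?_ h
  simp [config]

theorem run_detect_ticks (n : ℕ) (u : Bool) (v : Reg) (b : List WorkSym) :
    ∃ v' : Reg, v'.flag = (v.flag || (!u && decide (0 < n))) ∧ v'.seenTail = v.seenTail ∧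
      v'.seenHead = v.seenHead ∧
      Run M e n (config M .detect v out i a r c (List.replicate n (.tick u) ++ f) b)
        (config M .detect v' out i a r c f (List.replicate n (.tick u) ++ b)) := by
  induction n generalizing v b with
  | zero => exact ⟨v, by simp, rfl, rfl, .refl 0 _⟩
  | succ n ih =>
    obtain ⟨v', hv, hv₁, hv₂, h⟩ := ih (detectReg { v with work := some (.tick u) }) (.tick u :: b)
    refine ⟨v', ?_, by simp [hv₁, detectReg], by simp [hv₂, detectReg], ?_⟩
    · rw [hv]; cases u <;> simp [detectReg]
    · rw [← replicate_append_cons n _ b, List.replicate_succ, List.cons_append]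
      exact run_detect_cons M e out i a r c _ b _ v h

/-- A number `n` has uncounted digits exactly if `k < n`, and it is no longer pending if `n < k`. So
a pending number whose digits are all counted is `k` itself; this is how the current vertex is
recognised without comparing numbers. -/
theorem run_detect_number (split : Bool → ℕ → Bool) (k : ℕ) (h : Bool) (n : ℕ) (v : Reg)
    (hv : v.flag = false) (b : List WorkSym) :
    ∃ v' : Reg, v'.flag = false ∧ v'.seenTail = (v.seenTail || (!h && decide (n = k))) ∧
      v'.seenHead = (v.seenHead || (h && decide (n = k))) ∧
      Run M e (n + 1)
        (config M .detect v out i a r c (number k h n (statusAfter split k h n) ++ f) b)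
        (config M .detect v' out i a r c f
          ((number k h n (statusDetected split k h n)).reverse ++ b)) := by
  obtain ⟨v₁, hv₁, ht₁, hh₁, h₁⟩ := run_detect_ticks M e out i a r c
    (List.replicate (min n k) (.tick true) ++ (.mark h (statusAfter split k h n) :: f))
    (n - k) false v b
  obtain ⟨v₂, hv₂, ht₂, hh₂, h₂⟩ := run_detect_ticks M e out i a r c
    (.mark h (statusAfter split k h n) :: f) (min n k) true v₁
    (List.replicate (n - k) (.tick false) ++ b)
  have hf : v₂.flag = decide (k < n) := by simp [hv₂, hv₁, hv]
  refine ⟨detectReg { v₂ with work := some (.mark h (statusAfter split k h n)) }, ?_, ?_, ?_, ?_⟩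
  · cases h <;> simp only [detectReg, Reg.current, Option.getD_some, statusAfter] <;> split_ifs <;> rfl
  · rw [← ht₁, ← ht₂]
    rcases lt_trichotomy n k with hk | rfl | hk <;> cases h <;>
      simp [detectReg, statusAfter, *, ne_of_lt, ne_of_gt, not_lt_of_gt]
  · rw [← hh₁, ← hh₂]
    rcases lt_trichotomy n k with hk | rfl | hk <;> cases h <;>
      simp [detectReg, statusAfter, *, ne_of_lt, ne_of_gt, not_lt_of_gt]
  · have h₃ := run_detect_cons M e out i a r c f
      (List.replicate (min n k) (.tick true) ++ (List.replicate (n - k) (.tick false) ++ b))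
      (.mark h (statusAfter split k h n)) v₂ (.refl 0 _)
    convert (h₁.trans h₂).trans h₃ using 1
    · omega
    · simp [number]
    · have : detectSym v₂.flag (.mark h (statusAfter split k h n)) =
          .mark h (statusDetected split k h n) := by
        rcases lt_trichotomy n k with hk | rfl | hk <;>
          simp [detectSym, statusAfter, statusDetected, *, ne_of_gt, not_lt_of_gt]
      rw [this]
      simp [number]

theorem run_detect (split : Bool → ℕ → Bool) (k : ℕ) (E : List (ℕ × ℕ)) (v : Reg)
    (hv : v.flag = false) (b : List WorkSym) :
    ∃ v' : Reg, v'.flag = false ∧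
      v'.seenTail = (v.seenTail || E.any fun x => x.1 = k) ∧
      v'.seenHead = (v.seenHead || E.any fun x => x.2 = k) ∧
      Run M e ((encodeEdges E).length + 1)
        (config M .detect v out i a r c (edgeWord k (statusAfter split k) E) b)
        (config M .update v' out i a r c []
          ((edgeWord k (statusDetected split k) E).reverse ++ b)) := by
  induction E generalizing v b with
  | nil =>
    refine ⟨{ v with work := none }, hv, by simp, by simp, run_step ?_ (.refl 0 _)⟩
    simp [config]
  | cons x E ih =>
    obtain ⟨v₁, hf₁, ht₁, hh₁, h₁⟩ := run_detect_number M e out i a r c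
      (number k true x.2 (statusAfter split k true x.2) ++ edgeWord k (statusAfter split k) E)
      split k false x.1 v hv b
    obtain ⟨v₂, hf₂, ht₂, hh₂, h₂⟩ := run_detect_number M e out i a r c
      (edgeWord k (statusAfter split k) E) split k true x.2 v₁ hf₁
      ((number k false x.1 (statusDetected split k false x.1)).reverse ++ b)
    obtain ⟨v₃, hf₃, ht₃, hh₃, h₃⟩ := ih v₂ hf₂
      ((number k true x.2 (statusDetected split k true x.2)).reverse ++
        ((number k false x.1 (statusDetected split k false x.1)).reverse ++ b))
    refine ⟨v₃, hf₃, ?_, ?_, ?_⟩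
    · simp [ht₃, ht₂, ht₁, Bool.or_assoc]
    · simp [hh₃, hh₂, hh₁, Bool.or_assoc]
    · convert (h₁.trans h₂).trans h₃ using 1
      · simp; omega
      · simp
      · simp

end Machine

/-! ### The effect of splitting on a list of edges -/

/-- Replace an endpoint by the next fresh vertex if required; returns the new endpoint and the next
fresh vertex. -/
def freshen (s : Bool) (a c : ℕ) : ℕ × ℕ :=
  if s then (c, c + 1) else (a, c)

/-- Replace by fresh vertices `n, n + 1, …` those tails `a` of edges for which `split false a` holds
and those heads `a` for which `split true a` holds; returns the new edges and the new order. -/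
def splitEdges (split : Bool → ℕ → Bool) (n : ℕ) : List (ℕ × ℕ) → List (ℕ × ℕ) × ℕ
  | [] => ([], n)
  | x :: E =>
    let p := splitEdges split n E
    let y := freshen (split true x.2) x.2 p.2
    let z := freshen (split false x.1) x.1 y.2
    ((z.1, y.1) :: p.1, z.2)

/-- Whether a number is the tail of no edge (for heads), or the head of no edge (for tails). -/
def needsSplit (E : List (ℕ × ℕ)) (h : Bool) (a : ℕ) : Bool :=
  !E.any fun x => (if h then x.1 else x.2) = a

theorem freshen_snd_le (s : Bool) (a c : ℕ) : (freshen s a c).2 ≤ c + 1 := by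
  unfold freshen; split_ifs <;> simp

theorem splitEdges_snd_le (split : Bool → ℕ → Bool) (n : ℕ) (E : List (ℕ × ℕ)) :
    (splitEdges split n E).2 ≤ n + 2 * E.length := by
  induction E with
  | nil => simp [splitEdges]
  | cons x E ih =>
    have h₁ := freshen_snd_le (split true x.2) x.2 (splitEdges split n E).2
    have h₂ := freshen_snd_le (split false x.1) x.1
      (freshen (split true x.2) x.2 (splitEdges split n E).2).2
    simp only [splitEdges, List.length_cons]
    omega

theorem two_mul_length_le (E : List (ℕ × ℕ)) : 2 * E.length ≤ (encodeEdges E).length := by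
  induction E with
  | nil => simp
  | cons x E ih => simp; omega

section Machine

variable (M : FinTM2) (e : M.Γ M.k₀ ≃ Sym)

variable (out : List (M.Γ M.k₀)) (i a r c : List Sym) (f b : List WorkSym)

attribute [local simp] splitProgram readSym readWork pushTick pushWork write ifReg setReg gotoPhase
  Reg.current

/-! #### Update -/

/-- One step of the update pass. -/
theorem run_update_cons (x : WorkSym) (v : Reg) {n : ℕ} {y : SplitCfg M}
    (h : Run M e n (config M .update (updateReg { v with work := some x }) out i a r c
      (updateSym { v with work := some x } x :: f) b) y) :
    Run M e (n + 1) (config M .update v out i a r c f (x :: b)) y := by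
  refine run_step ?_ h
  simp [config]

/-- A digit changes only if it is uncounted while `flag` is set, so the hypothesis makes the block
pass unchanged. -/
theorem run_update_ticks (n : ℕ) (u : Bool) (v : Reg) (hv : u = true ∨ v.flag = false)
    (f : List WorkSym) :
    ∃ v' : Reg, v'.flag = v.flag ∧ v'.seenTail = v.seenTail ∧ v'.seenHead = v.seenHead ∧
      Run M e n (config M .update v out i a r c f (List.replicate n (.tick u) ++ b))
        (config M .update v' out i a r c (List.replicate n (.tick u) ++ f) b) := by
  induction n generalizing v f with
  | zero => exact ⟨v, rfl, rfl, rfl, .refl 0 _⟩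
  | succ n ih =>
    have hf : (updateReg { v with work := some (.tick u) }).flag = v.flag := by
      rcases hv with rfl | hv <;> simp [updateReg, *]
    obtain ⟨v', hv₀, hv₁, hv₂, h⟩ := ih (updateReg { v with work := some (.tick u) })
      (by rwa [hf]) (.tick u :: f)
    refine ⟨v', hv₀.trans hf, by simp [hv₁, updateReg], by simp [hv₂, updateReg], ?_⟩
    rw [← replicate_append_cons n _ f, List.replicate_succ, List.cons_append]
    refine run_update_cons M e out i a r c _ _ _ v ?_
    convert h using 2
    rcases hv with rfl | hv <;> simp [updateSym, *]

/-- The mark is met first and sets `flag` exactly if `k < n`. The flag survives the counted digits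
and is spent on the first uncounted one. A hit number has no digit left to count; its mark receives
the verdict stored in the registers. -/
theorem run_update_number (split : Bool → ℕ → Bool) (k : ℕ) (h : Bool) (n : ℕ) (v : Reg)
    (hv : ∀ h, split h k = !(if h then v.seenTail else v.seenHead)) (f : List WorkSym) :
    ∃ v' : Reg, v'.seenTail = v.seenTail ∧ v'.seenHead = v.seenHead ∧
      Run M e (n + 1)
        (config M .update v out i a r c f
          ((number k h n (statusDetected split k h n)).reverse ++ b))
        (config M .update v' out i a r c
          (number (k + 1) h n (statusAfter split (k + 1) h n) ++ f) b) := by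
  set x : WorkSym := .mark h (statusDetected split k h n) with hx
  set v₀ := updateReg { v with work := some x } with hv₀
  have ht₀ : v₀.seenTail = v.seenTail := by
    simp only [hv₀, hx, updateReg, Reg.current, Option.getD_some]; split <;> rfl
  have hh₀ : v₀.seenHead = v.seenHead := by
    simp only [hv₀, hx, updateReg, Reg.current, Option.getD_some]; split <;> rfl
  have hf₀ : v₀.flag = decide (k < n) := by
    rcases lt_trichotomy n k with hk | rfl | hk <;>
      simp [updateReg, statusDetected, *, ne_of_gt, not_lt_of_gt]
  have hs : updateSym { v with work := some x } x =
      .mark h (statusAfter split (k + 1) h n) := by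
    rcases lt_trichotomy n k with hk | rfl | hk
    · simp [hx, updateSym, statusAfter, statusDetected, hk, Nat.lt_succ_of_lt hk]
    · simp [hx, updateSym, statusAfter, statusDetected, hv]
    · have h₁ : ¬ n < k := by omega
      have h₂ : n ≠ k := by omega
      have h₃ : ¬ n < k + 1 := by omega
      simp [hx, updateSym, statusAfter, statusDetected, h₁, h₂, h₃]
  obtain ⟨v₁, hf₁, ht₁, hh₁, h₁⟩ := run_update_ticks M e out i a r c
    (List.replicate (n - k) (.tick false) ++ b) (min n k) true v₀ (.inl rfl)
    (.mark h (statusAfter split (k + 1) h n) :: f)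
  have h₀ := run_update_cons M e out i a r c f
    (List.replicate (min n k) (.tick true) ++ (List.replicate (n - k) (.tick false) ++ b)) x v
    (by rw [hs]; exact h₁)
  -- For `n ≤ k` there is no uncounted digit and the pass ends here; otherwise exactly one of the `n
  -- - k` uncounted digits is converted.
  rcases le_or_gt n k with hk | hk
  · refine ⟨v₁, ht₁.trans ht₀, hh₁.trans hh₀, ?_⟩
    have e₁ : n - k = 0 := by omega
    have e₂ : n - (k + 1) = 0 := by omega
    have e₃ : min n k = n := by omega
    have e₄ : min n (k + 1) = n := by omega
    rw [e₁, e₃] at h₀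
    simpa [number, e₁, e₂, e₃, e₄] using h₀
  · have hf₁' : v₁.flag = true := by simp [hf₁, hf₀, hk]
    set v₂ := updateReg { v₁ with work := some (.tick false) } with hv₂
    obtain ⟨v₃, hf₃, ht₃, hh₃, h₃⟩ := run_update_ticks M e out i a r c b (n - (k + 1)) false v₂
      (.inr (by simp [hv₂, updateReg]))
      (.tick true :: (List.replicate (min n k) (.tick true) ++
        (.mark h (statusAfter split (k + 1) h n) :: f)))
    refine ⟨v₃, by simp [ht₃, hv₂, updateReg, ht₁, ht₀], by simp [hh₃, hv₂, updateReg, hh₁, hh₀], ?_⟩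
    have hs₂ : updateSym { v₁ with work := some (.tick false) } (.tick false) = .tick true := by
      simp [updateSym, hf₁']
    have h₂ := run_update_cons M e out i a r c (List.replicate (min n k) (.tick true) ++
        (.mark h (statusAfter split (k + 1) h n) :: f))
      (List.replicate (n - (k + 1)) (.tick false) ++ b) (.tick false) v₁ (n := n - (k + 1))
      (h₃.congr (by rw [hs₂]) rfl)
    have e₁ : n - k = n - (k + 1) + 1 := by omega
    have e₃ : min n k = k := by omega
    have e₄ : min n (k + 1) = k + 1 := by omega
    rw [← List.cons_append, ← List.replicate_succ, ← e₁] at h₂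
    convert h₀.trans h₂ using 1
    · omega
    · simp [number, hx]
    · simp [number, e₃, e₄, List.replicate_succ]

theorem run_update (split : Bool → ℕ → Bool) (k : ℕ) (E : List (ℕ × ℕ)) (v : Reg)
    (hv : ∀ h, split h k = !(if h then v.seenTail else v.seenHead)) (b f : List WorkSym) :
    ∃ v' : Reg, v'.seenTail = v.seenTail ∧ v'.seenHead = v.seenHead ∧
      Run M e (encodeEdges E).length
        (config M .update v out i a r c f ((edgeWord k (statusDetected split k) E).reverse ++ b))
        (config M .update v' out i a r c (edgeWord (k + 1) (statusAfter split (k + 1)) E ++ f)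
          b) := by
  induction E generalizing b with
  | nil => exact ⟨v, rfl, rfl, .refl 0 _⟩
  | cons x E ih =>
    obtain ⟨v₁, ht₁, hh₁, h₁⟩ := ih
      ((number k true x.2 (statusDetected split k true x.2)).reverse ++
        ((number k false x.1 (statusDetected split k false x.1)).reverse ++ b))
    obtain ⟨v₂, ht₂, hh₂, h₂⟩ := run_update_number M e out i a r c
      ((number k false x.1 (statusDetected split k false x.1)).reverse ++ b) split k true x.2 v₁
      (by rwa [ht₁, hh₁]) (edgeWord (k + 1) (statusAfter split (k + 1)) E ++ f)
    obtain ⟨v₃, ht₃, hh₃, h₃⟩ := run_update_number M e out i a r c b split k false x.1 v₂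
      (by rwa [ht₂, hh₂, ht₁, hh₁]) (number (k + 1) true x.2 (statusAfter split (k + 1) true x.2) ++
        (edgeWord (k + 1) (statusAfter split (k + 1)) E ++ f))
    refine ⟨v₃, by rw [ht₃, ht₂, ht₁], by rw [hh₃, hh₂, hh₁], ?_⟩
    convert (h₁.trans h₂).trans h₃ using 1
    · simp; omega
    · simp
    · simp

/-! ### Complete rounds -/

/-- Detection leaves in the registers whether `k` is a tail and whether it is a head, which is what
`needsSplit` at `k` asks; the update pass then records the answer at every occurrence of `k`. -/
theorem run_round (E : List (ℕ × ℕ)) (k : ℕ) (v : Reg) (x : Sym) :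
    ∃ v' : Reg, Run M e (2 * (encodeEdges E).length + 3)
      (config M .round v out i a (x :: r) c (edgeWord k (statusAfter (needsSplit E) k) E) [])
      (config M .round v' out i a r c
        (edgeWord (k + 1) (statusAfter (needsSplit E) (k + 1)) E) []) := by
  obtain ⟨v₁, -, ht₁, hh₁, h₁⟩ := run_detect M e out i a r c (needsSplit E) k E
    { sym := some x } rfl []
  obtain ⟨v₂, ht₂, hh₂, h₂⟩ := run_update M e out i a r c (needsSplit E) k E v₁
    (by rintro (_ | _) <;> simp [needsSplit, ht₁, hh₁]) [] []
  have h₃ : Run M e 1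
      (config M .update v₂ out i a r c
        (edgeWord (k + 1) (statusAfter (needsSplit E) (k + 1)) E ++ []) [])
      (config M .round { v₂ with work := none } out i a r c
        (edgeWord (k + 1) (statusAfter (needsSplit E) (k + 1)) E) []) :=
    run_step (by simp [config]) (.refl 0 _)
  refine ⟨_, (run_step ?_ ((h₁.trans h₂).trans h₃)).mono (by omega)⟩
  simp [config]

theorem run_rounds (E : List (ℕ × ℕ)) (n k : ℕ) (v : Reg) :
    ∃ v' : Reg, v'.flag = false ∧ Run M e (n * (2 * (encodeEdges E).length + 3) + 1)
      (config M .round v out i a (List.replicate n .tick) c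
        (edgeWord k (statusAfter (needsSplit E) k) E) [])
      (config M .toBack v' out i a [] c
        (edgeWord (k + n) (statusAfter (needsSplit E) (k + n)) E) []) := by
  induction n generalizing k v with
  | zero =>
    refine ⟨{ sym := none }, rfl, run_step ?_ (.refl _ _)⟩
    simp [config]
  | succ n ih =>
    obtain ⟨v₁, h₁⟩ := run_round M e out i a (List.replicate n .tick) c E k v .tick
    obtain ⟨v₂, hv₂, h₂⟩ := ih (k + 1) v₁
    rw [Nat.add_right_comm, Nat.add_assoc k n 1] at h₂
    exact ⟨v₂, hv₂, (h₁.trans h₂).mono (by generalize (encodeEdges E).length = L; linarith)⟩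

/-! #### Output -/

/-- Copying the counter empties its stack, so the digits are saved on `aux` for `restoreFresh`; the
lone tick left behind is the increment. -/
theorem run_writeFresh (n m : ℕ) (v : Reg) (out : List (M.Γ M.k₀)) :
    ∃ v' : Reg, v'.flag = v.flag ∧ Run M e (n + 1)
      (config M .writeFresh v out i (List.replicate m .tick) r (List.replicate n .tick) f b)
      (config M .restoreFresh v' (List.replicate n (e.symm .tick) ++ out) i
        (List.replicate (n + m) .tick) r [.tick] f b) := by
  induction n generalizing m v out with
  | zero =>
    refine ⟨{ v with sym := none }, rfl, run_step ?_ (.refl 0 _)⟩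
    simp [config]
  | succ n ih =>
    obtain ⟨v', hv, h⟩ := ih (m + 1) { v with sym := some .tick } (e.symm .tick :: out)
    refine ⟨v', hv, ?_⟩
    rw [← replicate_append_cons n _ out, Nat.add_right_comm n 1 m, Nat.add_assoc n m 1]
    exact run_step (by simp [config, List.replicate_succ]) h

theorem run_restoreFresh (n m : ℕ) (v : Reg) :
    ∃ v' : Reg, v'.flag = v.flag ∧ Run M e (n + 1)
      (config M .restoreFresh v out i (List.replicate n .tick) r (List.replicate m .tick) f b)
      (config M .writeEdges v' out i [] r (List.replicate (n + m) .tick) f b) := by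
  induction n generalizing m v with
  | zero =>
    refine ⟨{ v with sym := none }, rfl, run_step ?_ (.refl 0 _)⟩
    simp [config]
  | succ n ih =>
    obtain ⟨v', hv, h⟩ := ih (m + 1) { v with sym := some .tick }
    refine ⟨v', hv, ?_⟩
    rw [Nat.add_right_comm n 1 m, Nat.add_assoc n m 1]
    exact run_step (by simp [config, List.replicate_succ]) h

theorem run_writeTicks (n : ℕ) (u : Bool) (v : Reg) (out : List (M.Γ M.k₀)) :
    ∃ v' : Reg, Run M e n
      (config M .writeEdges v out i a r c f (List.replicate n (.tick u) ++ b))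
      (config M .writeEdges v'
        ((if v.flag then List.replicate n (e.symm .tick) else []) ++ out) i a r c f b) := by
  induction n generalizing v out with
  | zero => exact ⟨v, by simpa using .refl 0 _⟩
  | succ n ih =>
    obtain ⟨v', h⟩ := ih { v with work := some (.tick u) }
      (if v.flag then e.symm .tick :: out else out)
    refine ⟨v', ?_⟩
    have : (if v.flag then List.replicate (n + 1) (e.symm .tick) else []) ++ out =
        (if v.flag then List.replicate n (e.symm .tick) else []) ++
          (if v.flag then e.symm .tick :: out else out) := by
      split_ifs
      · rw [replicate_append_cons]
      · rfl
    rw [this]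
    refine run_step ?_ h
    cases hv : v.flag <;> simp [config, List.replicate_succ, hv]

/-- `B` is a uniform bound for the fresh counter; copying and restoring the counter accounts for the
summand `2 * B + 2`. -/
theorem run_writeNumber (k : ℕ) (h : Bool) (n : ℕ) (hn : n < k) (s : Bool) (m B : ℕ) (hB : m ≤ B)
    (v : Reg) (out : List (M.Γ M.k₀)) :
    ∃ v' : Reg, Run M e (n + 1 + (2 * B + 2))
      (config M .writeEdges v out i [] r (List.replicate m .tick) f
        ((number k h n (.done s)).reverse ++ b))
      (config M .writeEdges v' ((encodeNat (freshen s n m).1).map e.symm ++ out) i [] r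
        (List.replicate (freshen s n m).2 .tick) f b) := by
  have e₁ : n - k = 0 := by omega
  have e₂ : min n k = n := by omega
  have e₃ : (number k h n (.done s)).reverse ++ b =
      .mark h (.done s) :: (List.replicate n (.tick true) ++ b) := by simp [number, e₁, e₂]
  rw [e₃]
  cases s
  · obtain ⟨v', h'⟩ := run_writeTicks M e i [] r (List.replicate m .tick) f b n true
      { v with work := some (.mark h (.done false)), flag := true } (e.symm .sep :: out)
    refine ⟨v', .mono (m := n + 1) ?_ (by omega)⟩
    simp only [if_true] at h'
    have e₄ : (encodeNat (freshen false n m).1).map e.symm ++ out =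
        List.replicate n (e.symm .tick) ++ e.symm .sep :: out := by simp [encodeNat, freshen]
    rw [e₄]
    exact run_step (by simp [config]) h'
  · obtain ⟨v₁, hv₁, h₁⟩ := run_writeFresh M e i r f (List.replicate n (.tick true) ++ b) m 0
      { v with work := some (.mark h (.done true)), flag := false } (e.symm .sep :: out)
    obtain ⟨v₂, hv₂, h₂⟩ := run_restoreFresh M e
      (List.replicate m (e.symm .tick) ++ e.symm .sep :: out)
      i r f (List.replicate n (.tick true) ++ b) m 1 v₁
    obtain ⟨v₃, h₃⟩ := run_writeTicks M e i [] r (List.replicate (m + 1) .tick) f b n true v₂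
      (List.replicate m (e.symm .tick) ++ e.symm .sep :: out)
    refine ⟨v₃, .mono (m := m + 1 + (m + 1) + n + 1) ?_ (by omega)⟩
    have hv : v₂.flag = false := by rw [hv₂, hv₁]
    simp only [hv, Bool.false_eq_true, if_false, List.nil_append] at h₃
    have e₄ : (encodeNat (freshen true n m).1).map e.symm ++ out =
        List.replicate m (e.symm .tick) ++ e.symm .sep :: out := by simp [encodeNat, freshen]
    rw [e₄]
    exact run_step (by simp [config]) ((h₁.trans h₂).trans h₃)

/-- The stack yields the last edge first and each head before its tail. `splitEdges` hands out fresh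
vertices in this same order. -/
theorem run_writeEdges (split : Bool → ℕ → Bool) (k : ℕ) (E : List (ℕ × ℕ))
    (hE : ∀ x ∈ E, x.1 < k ∧ x.2 < k) (n B : ℕ) (hB : n + 2 * E.length ≤ B) (v : Reg)
    (b : List WorkSym) :
    ∃ v' : Reg, Run M e ((encodeEdges E).length + 2 * E.length * (2 * B + 2))
      (config M .writeEdges v out i [] r (List.replicate n .tick) f
        ((edgeWord k (statusAfter split k) E).reverse ++ b))
      (config M .writeEdges v' ((encodeEdges (splitEdges split n E).1).map e.symm ++ out) i [] r
        (List.replicate (splitEdges split n E).2 .tick) f b) := by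
  induction E generalizing b v with
  | nil => exact ⟨v, .refl _ _⟩
  | cons x E ih =>
    have hx := hE x (by simp)
    rw [List.length_cons] at hB
    obtain ⟨v₁, h₁⟩ := ih (fun y hy => hE y (by simp [hy])) (by omega) v
      ((number k true x.2 (statusAfter split k true x.2)).reverse ++
        ((number k false x.1 (statusAfter split k false x.1)).reverse ++ b))
    have hm := splitEdges_snd_le split n E
    set p := splitEdges split n E with hp
    set y := freshen (split true x.2) x.2 p.2 with hy
    have hm' : y.2 ≤ p.2 + 1 := freshen_snd_le _ _ _
    obtain ⟨v₂, h₂⟩ := run_writeNumber M e i r f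
      ((number k false x.1 (statusAfter split k false x.1)).reverse ++ b)
      k true x.2 hx.2 (split true x.2) p.2 B (by omega) v₁ ((encodeEdges p.1).map e.symm ++ out)
    obtain ⟨v₃, h₃⟩ := run_writeNumber M e i r f b k false x.1 hx.1 (split false x.1) y.2 B
      (by omega) v₂ ((encodeNat y.1).map e.symm ++ ((encodeEdges p.1).map e.symm ++ out))
    refine ⟨v₃, ?_⟩
    have e₁ : statusAfter split k true x.2 = .done (split true x.2) := if_pos hx.2
    have e₂ : statusAfter split k false x.1 = .done (split false x.1) := if_pos hx.1
    rw [e₁] at h₁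
    rw [e₂] at h₁ h₂
    refine ((h₁.trans (h₂.trans h₃)).mono ?_).congr ?_ ?_
    · simp only [encodeEdges_cons, List.length_append, length_encodeNat, List.length_cons]
      ring_nf; omega
    · simp [e₁, e₂]
    · simp [splitEdges, ← hp, ← hy]

theorem run_writeOrder (n : ℕ) (v : Reg) (out : List (M.Γ M.k₀)) :
    Run M e (n + 1) (config M .writeOrder v out i a r (List.replicate n .tick) f b)
      ⟨some (.inl M.main), (M.initialState, {}),
        contents M (List.replicate n (e.symm .tick) ++ out) i a r [] f b⟩ := by
  induction n generalizing v out with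
  | zero =>
    refine run_step ?_ (.refl 0 _)
    simp
  | succ n ih =>
    rw [← replicate_append_cons n _ out]
    exact run_step (by simp [config, List.replicate_succ])
      (ih { v with sym := some .tick } (e.symm .tick :: out))

/-- The machine replaces its input by the split instance and then starts `M`. -/
theorem run_split (n : ℕ) (E : List (ℕ × ℕ)) (hE : ∀ x ∈ E, x.1 < n ∧ x.2 < n) (w : List Sym)
    (L : ℕ) (hL : n + (encodeEdges E).length + w.length + 2 ≤ L) :
    Run M e (30 * L ^ 2)
      (config M .readOrder {} [] (encodeNat n ++ encodeEdges E ++ [.endGraph] ++ w) [] [] [] [] [])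
      ⟨some (.inl M.main), (M.initialState, {}),
        contents M ((encodeNat (splitEdges (needsSplit E) n E).2 ++
          encodeEdges (splitEdges (needsSplit E) n E).1 ++ [Sym.endGraph] ++ w).map e.symm)
          [] [] [] [] [] []⟩ := by
  obtain ⟨v₁, hv₁, h₁⟩ := run_readOrder M e [] [] [] [] n {} (encodeEdges E ++ .endGraph :: w) [] []
  simp only [List.append_nil] at h₁
  obtain ⟨v₂, h₂⟩ := run_readEdges M e [] [] (List.replicate n .tick) (List.replicate n .tick) [] E
    v₁ hv₁ w []
  obtain ⟨v₃, h₃⟩ := run_readExtra M e [] (List.replicate n .tick) (List.replicate n .tick) []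
    ((edgeWord 0 (fun _ _ => .pending) E).reverse ++ []) w [] v₂
  obtain ⟨v₄, h₄⟩ := run_writeExtra M e [] (List.replicate n .tick) (List.replicate n .tick) []
    ((edgeWord 0 (fun _ _ => .pending) E).reverse ++ []) (w.reverse ++ []) v₃ []
  obtain ⟨v₅, h₅⟩ := run_toFront M e (e.symm .endGraph :: ((w.reverse ++ []).reverse.map e.symm ++ []))
    [] [] (List.replicate n .tick) (List.replicate n .tick)
    ((edgeWord 0 (fun _ _ => .pending) E).reverse ++ []) [] v₄
  simp only [List.append_nil, List.reverse_reverse] at h₂ h₃ h₄ h₅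
  obtain ⟨v₆, hv₆, h₆⟩ := run_rounds M e (e.symm .endGraph :: w.map e.symm) [] []
    (List.replicate n .tick) E n 0 v₅
  rw [Nat.zero_add] at h₆
  obtain ⟨v₇, -, h₇⟩ := run_toBack M e (e.symm .endGraph :: w.map e.symm) [] [] []
    (List.replicate n .tick) (edgeWord n (statusAfter (needsSplit E) n) E) [] v₆ hv₆
  have hlen := two_mul_length_le E
  obtain ⟨v₈, h₈⟩ := run_writeEdges M e (e.symm .endGraph :: w.map e.symm) [] [] []
    (needsSplit E) n E hE n L (by omega) v₇ []
  set out : List (M.Γ M.k₀) := (encodeEdges (splitEdges (needsSplit E) n E).1).map e.symm ++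
    e.symm .endGraph :: w.map e.symm with hout
  have h₉ : Run M e 1 (config M .writeEdges v₈ out [] [] []
        (List.replicate (splitEdges (needsSplit E) n E).2 .tick) [] [])
      (config M .writeOrder { v₈ with work := none } (e.symm .sep :: out) [] [] []
        (List.replicate (splitEdges (needsSplit E) n E).2 .tick) [] []) :=
    run_step (by simp [config]) (.refl 0 _)
  have h₁₀ := run_writeOrder M e [] [] [] [] [] (splitEdges (needsSplit E) n E).2
    { v₈ with work := none } (e.symm .sep :: out)
  have hm := splitEdges_snd_le (needsSplit E) n E
  have hstatus : statusAfter (needsSplit E) 0 = fun _ _ => .pending := by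
    funext h a; simp [statusAfter]
  rw [hstatus] at h₆
  simp only [List.append_nil] at h₇ h₈
  refine ((h₁.trans (h₂.trans (h₃.trans (h₄.trans (h₅.trans (h₆.trans (h₇.trans (h₈.trans
    (h₉.trans h₁₀))))))))).mono ?_).congr (by simp) ?_
  -- The rounds and the writing of edges cost about `2 * L ^ 2` each; everything else is linear and
  -- is absorbed because `2 ≤ L`.
  · simp only [List.length_reverse, length_edgeWord]
    have a₁ : n * (2 * (encodeEdges E).length + 3) ≤ L * (2 * L + 3) :=
      Nat.mul_le_mul (by omega) (by omega)
    have a₂ : 2 * E.length * (2 * L + 2) ≤ L * (2 * L + 2) := Nat.mul_le_mul_right _ (by omega)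
    have a₃ : 2 * L ≤ L * L := Nat.mul_le_mul_right _ (by omega)
    have a₄ : L * (2 * L + 3) = 2 * (L * L) + 3 * L := by ring
    have a₅ : L * (2 * L + 2) = 2 * (L * L) + 2 * L := by ring
    rw [pow_two]
    omega
  · simp [hout, encodeNat]

end Machine

/-! ### Simulation of the given machine -/

section Machine

variable (M : FinTM2) (e : M.Γ M.k₀ ≃ Sym)

/-- A configuration of `M` as a configuration of the larger machine. -/
def embedCfg (c : TM2.Cfg M.Γ M.Λ M.σ) : SplitCfg M :=
  ⟨c.l.map .inl, (c.var, {}), fun k => match k with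
    | .inl k => c.stk k
    | .inr _ => []⟩

theorem embedCfg_update (S : ∀ k, List (M.Γ k)) (k : M.K) (x : List (M.Γ k)) :
    (fun k' => match k' with
      | .inl k' => Function.update S k x k'
      | .inr _ => [] : ∀ k', List (Alphabet M k')) =
    Function.update (fun k' => match k' with
      | .inl k' => S k'
      | .inr _ => [] : ∀ k', List (Alphabet M k')) (.inl k) x := by
  funext k'
  rcases k' with k' | k'
  · rcases eq_or_ne k' k with rfl | hk
    · simp
    · rw [Function.update_of_ne (by simpa using hk)]
      exact Function.update_of_ne hk _ _
  · rw [Function.update_of_ne (by simp)]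

theorem stepAux_liftStmt (q : TM2.Stmt M.Γ M.Λ M.σ) (v : M.σ) (S : ∀ k, List (M.Γ k)) :
    TM2.stepAux (liftStmt q) (v, ({} : Reg)) (embedCfg M ⟨none, v, S⟩).stk =
      embedCfg M (TM2.stepAux q v S) := by
  induction q generalizing v S with
  | push k f q ih =>
    rw [TM2.stepAux, ← ih]
    simp only [liftStmt, TM2.stepAux, embedCfg, embedCfg_update]
  | peek k f q ih =>
    rw [TM2.stepAux, ← ih]
    simp only [liftStmt, TM2.stepAux, embedCfg]
  | pop k f q ih =>
    rw [TM2.stepAux, ← ih]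
    simp only [liftStmt, TM2.stepAux, embedCfg, embedCfg_update]
  | load f q ih =>
    rw [TM2.stepAux, ← ih]
    simp only [liftStmt, TM2.stepAux, embedCfg]
  | branch p q q' ih ih' =>
    rw [TM2.stepAux, liftStmt, TM2.stepAux]
    cases h : p v
    · simpa [h] using ih' v S
    · simpa [h] using ih v S
  | goto l => rfl
  | halt => rfl

theorem step_embedCfg (c : TM2.Cfg M.Γ M.Λ M.σ) :
    TM2.step (splitProgram M e) (embedCfg M c) = (TM2.step M.m c).map (embedCfg M) := by
  rcases c with ⟨_ | l, v, S⟩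
  · rfl
  · exact congrArg some (stepAux_liftStmt M (M.m l) v S)

/-- `embedCfg` commutes with single steps, hence with their iterates on `Option`, halting included;
the time bound is unchanged. -/
theorem run_embedCfg {n : ℕ} {c d : TM2.Cfg M.Γ M.Λ M.σ} (h : ReachesIn (TM2.step M.m) n c d) :
    Run M e n (embedCfg M c) (embedCfg M d) := by
  obtain ⟨⟨⟨t, ht⟩, htn⟩⟩ := h
  refine ⟨⟨⟨t, ?_⟩, htn⟩⟩
  have key : ∀ (t : ℕ) (o : Option (TM2.Cfg M.Γ M.Λ M.σ)),
      (flip bind (TM2.step (splitProgram M e)))^[t] (o.map (embedCfg M)) =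
        ((flip bind (TM2.step M.m))^[t] o).map (embedCfg M) := by
    intro t
    induction t with
    | zero => intro o; rfl
    | succ t ih =>
      intro o
      rw [Function.iterate_succ_apply, Function.iterate_succ_apply, ← ih]
      congr 1
      cases o with
      | none => rfl
      | some c => exact step_embedCfg M e c
  exact (key t (some c)).trans (congrArg (Option.map (embedCfg M)) ht)

theorem initList_splitMachine (w : List Sym) :
    initList (splitMachine M e) w = config M .readOrder {} [] w [] [] [] [] [] := by
  unfold initList config
  congr 1
  funext k
  rcases k with k | (_ | _)
  · exact (dif_neg (by simp [splitMachine])).trans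
      (by simp [contents]; rfl)
  · exact dif_pos rfl
  all_goals exact dif_neg (by simp [splitMachine])

theorem embedCfg_initList (s : List (M.Γ M.k₀)) :
    embedCfg M (initList M s) =
      ⟨some (.inl M.main), (M.initialState, {}), contents M s [] [] [] [] [] []⟩ := by
  unfold embedCfg
  congr 1
  funext k
  rcases k with k | (_ | _)
  · rcases eq_or_ne k M.k₀ with rfl | hk
    · simp [initList]
    · simp [initList, contents, hk]
  all_goals rfl

/-- A correct output requires all stacks but the output stack to be empty and the registers to be
initial. This holds because the additional stacks and registers are cleared before `M` starts and
`M` never touches them. -/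
theorem haltList_splitMachine (s : List (M.Γ M.k₁)) :
    haltList (splitMachine M e) s = embedCfg M (haltList M s) := by
  unfold haltList embedCfg
  congr 1
  funext k
  rcases k with k | k
  · rcases eq_or_ne k M.k₁ with rfl | hk
    · refine (dif_pos rfl).trans (Eq.symm ?_)
      exact dif_pos rfl
    · refine (dif_neg (by simpa [splitMachine] using hk)).trans (Eq.symm ?_)
      exact dif_neg hk
  · exact dif_neg (by simp [splitMachine])

end Machine

/-- The machine that first splits the sources and sinks and then runs the given machine. -/
def splitComputableAux (M : TM2ComputableAux Sym Bool) : TM2ComputableAux Sym Bool where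
  tm := splitMachine M.tm M.inputAlphabet
  inputAlphabet := Equiv.refl Sym
  outputAlphabet := M.outputAlphabet

theorem splitComputableAux_outputs (M : TM2ComputableAux Sym Bool) {n : ℕ} {E : List (ℕ × ℕ)}
    (hE : ∀ x ∈ E, x.1 < n ∧ x.2 < n) (w : List Sym) (answer : Bool) {t : ℕ}
    (h : Nonempty (TM2OutputsInTime M.tm
      ((encodeNat (splitEdges (needsSplit E) n E).2 ++
        encodeEdges (splitEdges (needsSplit E) n E).1 ++ [Sym.endGraph] ++ w).map
          M.inputAlphabet.symm) (some ([answer].map M.outputAlphabet.symm)) t)) :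
    Nonempty (TM2OutputsInTime (splitComputableAux M).tm
      ((encodeNat n ++ encodeEdges E ++ [Sym.endGraph] ++ w).map
        (splitComputableAux M).inputAlphabet.symm)
      (some ([answer].map (splitComputableAux M).outputAlphabet.symm))
      (30 * (encodeNat n ++ encodeEdges E ++ [Sym.endGraph] ++ w).length ^ 2 + t)) := by
  have h₁ := run_split M.tm M.inputAlphabet n E hE w
    (encodeNat n ++ encodeEdges E ++ [Sym.endGraph] ++ w).length (by simp; omega)
  rw [← embedCfg_initList, ← initList_splitMachine M.tm M.inputAlphabet] at h₁
  have h₂ := run_embedCfg M.tm M.inputAlphabet h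
  rw [← haltList_splitMachine M.tm M.inputAlphabet] at h₂
  have := h₁.trans h₂
  have e₁ : (encodeNat n ++ encodeEdges E ++ [Sym.endGraph] ++ w).map
      (splitComputableAux M).inputAlphabet.symm =
      encodeNat n ++ encodeEdges E ++ [Sym.endGraph] ++ w := List.map_id _
  rw [e₁]
  exact this

/-! ### Quotients by identification of sources and sinks -/

/-- Glue the vertex `y` to the vertex `x`. -/
def glue {m : ℕ} {x y : Fin (m + 1)} (h : x ≠ y) (z : Fin (m + 1)) : Fin m :=
  (finSuccAboveEquiv y).symm (if hz : z = y then ⟨x, h⟩ else ⟨z, hz⟩)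

theorem glue_eq_iff {m : ℕ} {x y : Fin (m + 1)} (h : x ≠ y) (u v : Fin (m + 1)) :
    glue h u = glue h v ↔ u = v ∨ (u = x ∧ v = y) ∨ (u = y ∧ v = x) := by
  unfold glue
  rw [EmbeddingLike.apply_eq_iff_eq]
  split_ifs with h₁ h₂ h₂
  · simp [h₁, h₂]
  · simp only [Subtype.mk.injEq, h₁, h₂, true_and]
    grind
  · simp only [Subtype.mk.injEq, h₁, h₂, and_true]
    grind
  · simp [h₁, h₂]

theorem glue_surjective {m : ℕ} {x y : Fin (m + 1)} (h : x ≠ y) :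
    Function.Surjective (glue h) := by
  intro a
  refine ⟨(finSuccAboveEquiv y a : {z // z ≠ y}), ?_⟩
  unfold glue
  rw [dif_neg (finSuccAboveEquiv y a).2]
  simp

/-- A quotient of a digraph in which only sources and sinks are glued arises by source-sink
identification. -/
theorem equivalent_of_quotient {n : ℕ} (H : Digraph (Fin n)) (D : FinDigraph) (ψ : Fin n → Fin D.1)
    (hψ : Function.Surjective ψ)
    (hadj : ∀ p q, D.2.Adj p q ↔ ∃ u v, ψ u = p ∧ ψ v = q ∧ H.Adj u v)
    (hglue : ∀ x y, ψ x = ψ y → x ≠ y → IsSource D.2 (ψ x) ∨ IsSink D.2 (ψ x))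
    (hinj : ¬ Function.Injective ψ) :
    EquivalentUnderSourceSinkIdentification ⟨n, H⟩ D := by
  induction n with
  | zero => exact absurd (fun x => x.elim0) hinj
  | succ m ih =>
    -- Since `ψ` is a homomorphism, any vertex over a source of `D` is a source of `H`, and likewise
    -- for sinks; so `x` and `y` may be identified.
    obtain ⟨x, y, hxy, hne⟩ : ∃ x y, ψ x = ψ y ∧ x ≠ y := by
      simpa [Function.Injective] using hinj
    have hid : SourceSinkIdentifiable H x y := by
      refine (hglue x y hxy hne).imp (fun h => ⟨fun u hu => ?_, fun u hu => ?_⟩)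
        fun h => ⟨fun u hu => ?_, fun u hu => ?_⟩
      · exact h (ψ u) ((hadj _ _).2 ⟨u, x, rfl, rfl, hu⟩)
      · exact h (ψ u) ((hadj _ _).2 ⟨u, y, rfl, hxy.symm, hu⟩)
      · exact h (ψ u) ((hadj _ _).2 ⟨x, u, rfl, rfl, hu⟩)
      · exact h (ψ u) ((hadj _ _).2 ⟨y, u, hxy.symm, rfl, hu⟩)
    -- If only this pair is glued, a single step ends at `D` itself, its surjection absorbing any
    -- renaming of vertices. This is why `ψ` must not be injective: with no step left, `H` would
    -- only be isomorphic to `D`.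
    by_cases hall : ∀ u v, ψ u = ψ v → u = v ∨ (u = x ∧ v = y) ∨ (u = y ∧ v = x)
    · refine .single ⟨x, y, hne, hid, ψ, hψ, fun u v => ⟨hall u v, ?_⟩, hadj⟩
      rintro (rfl | ⟨rfl, rfl⟩ | ⟨rfl, rfl⟩)
      exacts [rfl, hxy, hxy.symm]
    · push Not at hall
      obtain ⟨u, v, huv, h₁, h₂, h₃⟩ := hall
      -- `ψ` is constant on the class `{x, y}`, so it descends along `glue` through any section.
      let s := Function.surjInv (glue_surjective hne)
      have hs : ∀ z, ψ (s (glue hne z)) = ψ z := by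
        intro z
        have := (glue_eq_iff hne _ z).1 (Function.surjInv_eq (glue_surjective hne) (glue hne z))
        rcases this with h | ⟨h, rfl⟩ | ⟨h, rfl⟩
        · exact congrArg ψ h
        · exact (congrArg ψ h).trans hxy
        · exact (congrArg ψ h).trans hxy.symm
      let H' : Digraph (Fin m) := ⟨fun p q => ∃ u v, glue hne u = p ∧ glue hne v = q ∧ H.Adj u v⟩
      have hstep : SourceSinkStep ⟨m + 1, H⟩ ⟨m, H'⟩ :=
        ⟨x, y, hne, hid, glue hne, glue_surjective hne, glue_eq_iff hne, fun _ _ => Iff.rfl⟩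
      refine Relation.ReflTransGen.head hstep
        (ih H' (ψ ∘ s) (fun p => ?_) (fun p q => ?_) (fun a b hab hne' => ?_) fun hinj' => ?_)
      · obtain ⟨z, rfl⟩ := hψ p
        exact ⟨glue hne z, hs z⟩
      · rw [hadj]
        constructor
        · rintro ⟨a, b, rfl, rfl, h⟩
          exact ⟨_, _, hs a, hs b, a, b, rfl, rfl, h⟩
        · rintro ⟨_, _, rfl, rfl, a, b, rfl, rfl, h⟩
          exact ⟨a, b, (hs a).symm, (hs b).symm, h⟩
      · exact hglue (s a) (s b) hab fun h => hne' (Function.injective_surjInv _ h)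
      -- The pair `u`, `v` is still apart after gluing `x` and `y`, but has the same image.
      · have := @hinj' (glue hne u) (glue hne v) (by simp [hs, huv])
        rw [glue_eq_iff] at this
        grind

open SimpleGraph

/-! ### Trees -/

/-- A connected graph has at least `|V| - 1` edges anyway, so an upper bound on the number of edges
suffices. -/
theorem isTree_of_connected_of_ncard_le {V : Type*} [Finite V] {G : SimpleGraph V}
    (h : G.Connected) (hc : G.edgeSet.ncard + 1 ≤ Nat.card V) : G.IsTree :=
  isTree_iff_connected_and_card.2 ⟨h, le_antisymm hc h.card_vert_le_card_edgeSet_add_one⟩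

/-- Attach a new node to the node `r` of a tree. -/
def attachLeaf {N : ℕ} (T : SimpleGraph (Fin N)) (r : Fin N) : SimpleGraph (Fin (N + 1)) :=
  T.map Fin.castSuccEmb ⊔ edge r.castSucc (Fin.last N)

theorem attachLeaf_castSucc {N : ℕ} (T : SimpleGraph (Fin N)) (r : Fin N) {a b : Fin N}
    (h : T.Adj a b) : (attachLeaf T r).Adj a.castSucc b.castSucc :=
  Or.inl ((T.map_adj_apply (f := Fin.castSuccEmb)).2 h)

theorem isTree_attachLeaf {N : ℕ} {T : SimpleGraph (Fin N)} (hT : T.IsTree) (r : Fin N) :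
    (attachLeaf T r).IsTree := by
  have hreach : ∀ a : Fin N, (attachLeaf T r).Reachable a.castSucc r.castSucc := fun a =>
    (hT.connected.preconnected a r).map ⟨Fin.castSucc, fun h => attachLeaf_castSucc T r h⟩
  have hlast : (attachLeaf T r).Reachable (Fin.last N) r.castSucc :=
    Adj.reachable (Or.inr (by simp [edge_adj, (Fin.castSucc_lt_last r).ne']))
  have hall : ∀ a, (attachLeaf T r).Reachable a r.castSucc := fun a => by
    induction a using Fin.lastCases with
    | last => exact hlast
    | cast a => exact hreach a
  refine isTree_of_connected_of_ncard_le
    { preconnected := fun a b => (hall a).trans (hall b).symm } ?_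
  have h₁ := (isTree_iff_connected_and_card.1 hT).2
  rw [Nat.card_fin, Nat.card_coe_set_eq] at h₁
  rw [Nat.card_fin, attachLeaf, edgeSet_sup, edgeSet_map]
  have h₂ := Set.ncard_union_le (Fin.castSuccEmb.sym2Map '' T.edgeSet)
    (edge r.castSucc (Fin.last N)).edgeSet
  have h₃ := Set.ncard_image_le (f := Fin.castSuccEmb.sym2Map) T.edgeSet.toFinite
  have h₄ : (edge r.castSucc (Fin.last N)).edgeSet.ncard ≤ 1 := by
    refine (Set.ncard_le_ncard (t := {s(r.castSucc, Fin.last N)}) ?_).trans (by simp)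
    simp [edge]
  omega

/-! ### Tree decompositions -/

/-- A family of bags on a tree that satisfies all the conditions on a tree decomposition, except
that some vertices may be in no bag, can be completed by bags of size one. -/
theorem exists_treeDecomposition {V : Type*} [Finite V] [DecidableEq V] (G : SimpleGraph V) (w : ℕ)
    {N : ℕ} (T : SimpleGraph (Fin N)) (hT : T.IsTree) (bag : Fin N → Finset V)
    (hcard : ∀ t, (bag t).card ≤ w + 1)
    (hadj : ∀ u v, G.Adj u v → ∃ t, u ∈ bag t ∧ v ∈ bag t)
    (hconn : ∀ v, (T.induce {t | v ∈ bag t}).Preconnected) :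
    ∃ D : TreeDecomposition G, ∀ t, (D.bag t).card ≤ w + 1 := by
  induction hm : {v | ∀ t, v ∉ bag t}.ncard generalizing N with
  | zero =>
    rw [Set.ncard_eq_zero] at hm
    refine ⟨⟨N, T, hT, bag, fun v => ?_, hadj, hconn⟩, hcard⟩
    by_contra! h
    exact Set.eq_empty_iff_forall_notMem.1 hm v h
  | succ m ih =>
    obtain ⟨x, hx⟩ : {v | ∀ t, v ∉ bag t}.Nonempty := by
      rw [← Set.ncard_pos]; omega
    have hx' : ∀ t, x ∉ bag t := hx
    obtain ⟨r⟩ := hT.connected.nonempty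
    have hb₁ : ∀ t, (Fin.snoc bag {x} : Fin (N + 1) → Finset V) t.castSucc = bag t := fun t =>
      Fin.snoc_castSucc (α := fun _ => Finset V) ..
    have hb₂ : (Fin.snoc bag {x} : Fin (N + 1) → Finset V) (Fin.last N) = {x} :=
      Fin.snoc_last (α := fun _ => Finset V) ..
    refine ih (attachLeaf T r) (isTree_attachLeaf hT r) (Fin.snoc bag {x}) (fun t => ?_)
      (fun u v h => ?_) (fun v => ?_) ?_
    · induction t using Fin.lastCases with
      | last => rw [hb₂]; simp
      | cast t => rw [hb₁]; exact hcard t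
    · obtain ⟨t, ht⟩ := hadj u v h
      exact ⟨t.castSucc, by rwa [hb₁]⟩
    · rcases eq_or_ne v x with rfl | hv
      · have : ∀ t : Fin (N + 1), v ∈ (Fin.snoc bag {v} : Fin (N + 1) → Finset V) t →
            t = Fin.last N := by
          intro t ht
          induction t using Fin.lastCases with
          | last => rfl
          | cast t => rw [hb₁] at ht; exact absurd ht (hx' t)
        rintro ⟨a, ha⟩ ⟨b, hb⟩
        obtain rfl := this a ha
        obtain rfl := this b hb
        exact Reachable.refl _
      · have : ∀ t ∈ {t : Fin (N + 1) | v ∈ (Fin.snoc bag {x} : Fin (N + 1) → Finset V) t},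
            ∃ t', v ∈ bag t' ∧ t'.castSucc = t := by
          intro t ht
          induction t using Fin.lastCases with
          | last => rw [Set.mem_ofPred_eq, hb₂] at ht; simp [hv] at ht
          | cast t => rw [Set.mem_ofPred_eq, hb₁] at ht; exact ⟨t, ht, rfl⟩
        rintro ⟨a, ha⟩ ⟨b, hb⟩
        obtain ⟨a, ha', rfl⟩ := this a ha
        obtain ⟨b, hb', rfl⟩ := this b hb
        let φ : T.induce {t | v ∈ bag t} →g (attachLeaf T r).induce
            {t : Fin (N + 1) | v ∈ (Fin.snoc bag {x} : Fin (N + 1) → Finset V) t} :=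
          ⟨fun t => ⟨t.1.castSucc, by rw [Set.mem_ofPred_eq, hb₁]; exact t.2⟩,
            fun h => attachLeaf_castSucc T r h⟩
        exact (hconn v ⟨a, ha'⟩ ⟨b, hb'⟩).map φ
    · have : {v | ∀ t, v ∉ (Fin.snoc bag {x} : Fin (N + 1) → Finset V) t} =
          {v | ∀ t, v ∉ bag t} \ {x} := by
        ext v
        simp [Fin.forall_fin_succ', hb₁, hb₂]
      rw [this, Set.ncard_sdiff_singleton_of_mem hx, hm]
      rfl

/-- Every inner node of a path in a tree that does not start the path has a neighbour such that the
edge to it separates the ends of the path. -/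
theorem exists_separating_neighbor {N : ℕ} {T : SimpleGraph (Fin N)} (hT : T.IsTree) {a b t : Fin N}
    (w : T.Walk a b) (hw : w.IsPath) (ht : t ∈ w.support) (hat : a ≠ t) :
    ∃ s, T.Adj s t ∧ ¬ (T.deleteEdges {s(s, t)}).Reachable t a ∧
      (T.deleteEdges {s(s, t)}).Reachable t b := by
  have hq : ∃ q : T.Walk t a, q.IsPath ∧ ∀ e ∈ q.edges, e ∉ (w.dropUntil t ht).edges := by
    -- Cut the path at `t`: the two parts share no edge. The wanted `s` is the neighbour of `t`
    -- towards `a`, and the part towards `b` avoids the edge to it.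
    refine ⟨(w.takeUntil t ht).reverse, (hw.takeUntil ht).reverse, fun e he => ?_⟩
    have hnd := hw.isTrail.edges_nodup
    rw [← w.take_spec ht, Walk.edges_append] at hnd
    rw [Walk.edges_reverse, List.mem_reverse] at he
    exact List.disjoint_of_nodup_append hnd he
  obtain ⟨q, hqp, hqe⟩ := hq
  cases q with
  | nil => exact absurd rfl hat
  | @cons _ s _ hts q =>
    rw [Walk.cons_isPath_iff] at hqp
    have hadj := hts.symm
    have hbridge := isAcyclic_iff_forall_adj_isBridge.1 hT.isAcyclic hadj
    refine ⟨s, hadj, fun hr => ?_, ?_⟩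
    · have hsa : (T.deleteEdges {s(s, t)}).Reachable s a := by
        refine ⟨q.toDeleteEdges _ fun e he hes => ?_⟩
        rw [Set.mem_singleton_iff] at hes
        subst hes
        exact hqp.2 (q.snd_mem_support_of_mem_edges he)
      exact isBridge_iff.1 hbridge (hsa.trans hr.symm)
    · refine ⟨(w.dropUntil t ht).toDeleteEdges _ fun e he hes => ?_⟩
      rw [Set.mem_singleton_iff] at hes
      subst hes
      exact hqe s(s, t) (by simp [Sym2.eq_swap]) he

/-- The vertices that lie on edges on both sides of a cut of a tree. -/
def cutVertices {V E : Type*} (ends : E → Finset V) {N : ℕ} (T : SimpleGraph (Fin N)) (p : E → Fin N)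
    (s t : Fin N) : Set V :=
  {x | ∃ e f, x ∈ ends e ∧ x ∈ ends f ∧ ¬ (T.deleteEdges {s(s, t)}).Reachable t (p e) ∧
    (T.deleteEdges {s(s, t)}).Reachable t (p f)}

/-- A placement of the edges of a graph at the nodes of a subcubic tree such that few vertices lie
on edges on both sides of a tree edge gives a bound on the tree-width. -/
theorem treeWidth_le_of_placement {V E : Type*} [Finite V] (G : SimpleGraph V)
    (ends : E → Finset V) (hends : ∀ e, (ends e).card ≤ 2) {N : ℕ} (T : SimpleGraph (Fin N))
    (hT : T.IsTree) (hdeg : ∀ t, (T.neighborSet t).ncard ≤ 3) (p : E → Fin N)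
    (hp : Function.Injective p) (k : ℕ)
    (hcut : ∀ s t, T.Adj s t → (cutVertices ends T p s t).ncard ≤ k)
    (hG : ∀ u v, G.Adj u v → ∃ e, u ∈ ends e ∧ v ∈ ends e) :
    treeWidth G ≤ 3 * k + 1 := by
  classical
  have := Fintype.ofFinite V
  -- A vertex is put on the subtree spanned by the places of its edges.
  let bag : Fin N → Finset V := fun t => {x | ∃ e f, x ∈ ends e ∧ x ∈ ends f ∧
    ∃ w : T.Walk (p e) (p f), w.IsPath ∧ t ∈ w.support}
  have hbag : ∀ t x, x ∈ bag t ↔ ∃ e f, x ∈ ends e ∧ x ∈ ends f ∧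
      ∃ w : T.Walk (p e) (p f), w.IsPath ∧ t ∈ w.support := by simp [bag]
  refine Nat.sInf_le (exists_treeDecomposition G (3 * k + 1) T hT bag (fun t => ?_)
    (fun u v h => ?_) fun v => ?_)
  -- A vertex in the bag of `t` lies on an edge placed at `t` or crosses a tree edge at `t`; this
  -- gives `2 + 3 * k` vertices.
  · have hsub : bag t ⊆ (Finset.univ.filter fun x => ∃ e, p e = t ∧ x ∈ ends e) ∪
        (Finset.univ.filter fun s => T.Adj s t).biUnion fun s =>
          Finset.univ.filter fun x => x ∈ cutVertices ends T p s t := by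
      intro x hx
      obtain ⟨e, f, he, hf, w, hw, ht⟩ := (hbag t x).1 hx
      simp only [Finset.mem_union, Finset.mem_filter, Finset.mem_univ, true_and,
        Finset.mem_biUnion]
      by_cases het : p e = t
      · exact .inl ⟨e, het, he⟩
      · obtain ⟨s, hst, h₁, h₂⟩ := exists_separating_neighbor hT w hw ht het
        exact .inr ⟨s, hst, e, f, he, hf, h₁, h₂⟩
    have h₁ : (Finset.univ.filter fun x => ∃ e, p e = t ∧ x ∈ ends e).card ≤ 2 := by
      by_cases h : ∃ e, p e = t
      · obtain ⟨e, rfl⟩ := h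
        refine (Finset.card_le_card fun x hx => ?_).trans (hends e)
        obtain ⟨e', he', hx⟩ := (Finset.mem_filter.1 hx).2
        exact hp he' ▸ hx
      · rw [Finset.card_eq_zero.2]
        · omega
        · ext x
          simp only [Finset.mem_filter, Finset.mem_univ, true_and, Finset.notMem_empty, iff_false]
          exact fun ⟨e, he, _⟩ => h ⟨e, he⟩
    have h₂ : (Finset.univ.filter fun s => T.Adj s t).card ≤ 3 := by
      refine le_trans (le_of_eq ?_) (hdeg t)
      rw [← Set.ncard_coe_finset]
      congr 1
      ext s
      simp [T.adj_comm]
    have h₃ := Finset.card_biUnion_le_card_mul (Finset.univ.filter fun s => T.Adj s t)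
      (fun s => Finset.univ.filter fun x => x ∈ cutVertices ends T p s t) k (fun s hs => by
        refine le_trans (le_of_eq ?_) (hcut s t (Finset.mem_filter.1 hs).2)
        rw [← Set.ncard_coe_finset]
        congr 1
        ext x
        simp)
    have h₄ := (Finset.card_le_card hsub).trans (Finset.card_union_le _ _)
    have h₅ := Nat.mul_le_mul_right k h₂
    omega
  · obtain ⟨e, hu, hv⟩ := hG u v h
    exact ⟨p e, (hbag _ _).2 ⟨e, e, hu, hu, .nil, .nil, by simp⟩,
      (hbag _ _).2 ⟨e, e, hv, hv, .nil, .nil, by simp⟩⟩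
  · have hplaced : ∀ e, v ∈ ends e → v ∈ bag (p e) := fun e he =>
      (hbag _ _).2 ⟨e, e, he, he, .nil, .nil, by simp⟩
    have hpath : ∀ e f (he : v ∈ ends e) (hf : v ∈ ends f),
        (T.induce {t | v ∈ bag t}).Reachable ⟨p e, hplaced e he⟩ ⟨p f, hplaced f hf⟩ := by
      intro e f he hf
      obtain ⟨w, hw, -⟩ := hT.existsUnique_path (p e) (p f)
      exact ⟨w.induce _ fun t ht => (hbag _ _).2 ⟨e, f, he, hf, w, hw, ht⟩⟩
    have hnode : ∀ t (ht : v ∈ bag t), ∃ f, ∃ hf : v ∈ ends f,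
        (T.induce {t | v ∈ bag t}).Reachable ⟨t, ht⟩ ⟨p f, hplaced f hf⟩ := by
      intro t ht
      obtain ⟨e, f, he, hf, w, hw, htw⟩ := (hbag _ _).1 ht
      exact ⟨f, hf, ⟨(w.dropUntil t htw).induce _ fun t' ht' =>
        (hbag _ _).2 ⟨e, f, he, hf, w, hw, w.support_dropUntil_subset_support htw ht'⟩⟩⟩
    rintro ⟨a, ha⟩ ⟨b, hb⟩
    obtain ⟨f, hf, h₁⟩ := hnode a ha
    obtain ⟨g, hg, h₂⟩ := hnode b hb
    exact (h₁.trans (hpath f g hf hg)).trans h₂.symm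

/-! ### Existence of layouts -/

/-- The node `b` of the caterpillar is the parent of the node `a`: the nodes below `m` form a path,
and the node `b + m` hangs from the node `b`. -/
def CaterpillarParent (m : ℕ) (a b : Fin (2 * m)) : Prop :=
  (b.val + 1 = a.val ∧ a.val < m) ∨ b.val + m = a.val

/-- The caterpillar with `m` leaves. -/
def caterpillar (m : ℕ) (hm : 2 ≤ m) : SimpleGraph (Fin (2 * m)) where
  Adj a b := CaterpillarParent m a b ∨ CaterpillarParent m b a
  symm := ⟨fun _ _ h => h.symm⟩
  loopless := ⟨fun a h => by unfold CaterpillarParent at h; omega⟩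

/-- Every node descends to `0` through its parents, and each edge joins a nonzero node to its unique
parent, so there are at most `2 * m - 1` edges. -/
theorem isTree_caterpillar (m : ℕ) (hm : 2 ≤ m) : (caterpillar m hm).IsTree := by
  have hpos : 0 < 2 * m := by omega
  have hroot : ∀ n (hn : n < 2 * m), (caterpillar m hm).Reachable ⟨n, hn⟩ ⟨0, hpos⟩ := by
    intro n
    induction n using Nat.strong_induction_on with
    | _ n ih =>
      intro hn
      rcases Nat.eq_zero_or_pos n with rfl | h0
      · exact Reachable.refl _
      · by_cases h : n < m
        · refine Reachable.trans (Adj.reachable (Or.inl (Or.inl ?_))) (ih (n - 1) (by omega)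
            (by omega))
          exact ⟨by simp; omega, h⟩
        · refine Reachable.trans (Adj.reachable (Or.inl (Or.inr ?_))) (ih (n - m) (by omega)
            (by omega))
          simp; omega
  have : Nonempty (Fin (2 * m)) := ⟨⟨0, hpos⟩⟩
  refine isTree_of_connected_of_ncard_le
    { preconnected := fun a b => (hroot a a.2).trans (hroot b b.2).symm } ?_
  let f : Fin (2 * m) → Fin (2 * m) := fun a =>
    ⟨if a.val < m then a.val - 1 else a.val - m, by split_ifs <;> omega⟩
  have hpar : ∀ a b, CaterpillarParent m a b → s(a, b) ∈ (fun a => s(a, f a)) '' {⟨0, hpos⟩}ᶜ := by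
    intro a b h
    have hb : b = f a := by
      ext
      simp only [f]
      unfold CaterpillarParent at h
      split_ifs <;> omega
    refine ⟨a, ?_, by rw [hb]⟩
    simp only [Set.mem_compl_iff, Set.mem_singleton_iff, Fin.ext_iff]
    unfold CaterpillarParent at h
    omega
  have hsub : (caterpillar m hm).edgeSet ⊆ (fun a => s(a, f a)) '' {⟨0, hpos⟩}ᶜ := by
    intro e he
    induction e with
    | h a b =>
      rcases he with h | h
      · exact hpar a b h
      · rw [Sym2.eq_swap]
        exact hpar b a h
  have h₁ := Set.ncard_le_ncard hsub (Set.toFinite _)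
  have h₂ := Set.ncard_image_le (f := fun a => s(a, f a))
    ({⟨0, hpos⟩}ᶜ : Set (Fin (2 * m))).toFinite
  have h₃ := Set.ncard_add_ncard_compl ({⟨0, hpos⟩} : Set (Fin (2 * m)))
  rw [Set.ncard_singleton] at h₃
  omega

theorem ncard_neighborSet_caterpillar_le (m : ℕ) (hm : 2 ≤ m) (t : Fin (2 * m)) :
    ((caterpillar m hm).neighborSet t).ncard ≤ 3 := by
  have hsub : Fin.val '' (caterpillar m hm).neighborSet t ⊆
      (if t.val < m then {t.val - 1, t.val + 1, t.val + m} else {t.val - m} : Set ℕ) := by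
    rintro _ ⟨b, hb, rfl⟩
    have hb' : CaterpillarParent m t b ∨ CaterpillarParent m b t := hb
    unfold CaterpillarParent at hb'
    split_ifs <;> simp <;> omega
  rw [← Set.ncard_image_of_injective _ Fin.val_injective]
  refine (Set.ncard_le_ncard hsub (by split_ifs <;> exact Set.toFinite _)).trans ?_
  split_ifs
  · refine (Set.ncard_insert_le _ _).trans ?_
    have := Set.ncard_insert_le (t.val + 1) {t.val + m}
    rw [Set.ncard_singleton] at this
    omega
  · simp

/-- A node of the path has its pendant node and, as `2 ≤ m`, at least one neighbour on the path;
hence exactly the pendant nodes are leaves. -/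
theorem ncard_neighborSet_caterpillar_eq_one (m : ℕ) (hm : 2 ≤ m) (t : Fin (2 * m)) :
    ((caterpillar m hm).neighborSet t).ncard = 1 ↔ m ≤ t.val := by
  constructor
  · intro h
    by_contra! ht
    obtain ⟨x, hx⟩ := Set.ncard_eq_one.1 h
    have h₁ : (⟨t.val + m, by omega⟩ : Fin (2 * m)) ∈ (caterpillar m hm).neighborSet t :=
      Or.inr (Or.inr rfl)
    have h₂ : ∃ b : Fin (2 * m), b.val < m ∧ b ∈ (caterpillar m hm).neighborSet t := by
      by_cases h0 : t.val = 0
      · exact ⟨⟨t.val + 1, by omega⟩, by simp; omega, Or.inr (Or.inl ⟨rfl, by simp; omega⟩)⟩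
      · exact ⟨⟨t.val - 1, by omega⟩, by simp; omega, Or.inl (Or.inl ⟨by simp; omega, ht⟩)⟩
    obtain ⟨b, hb, h₂⟩ := h₂
    rw [hx, Set.mem_singleton_iff] at h₁ h₂
    rw [h₂, ← h₁] at hb
    simp at hb
  · intro h
    rw [Set.ncard_eq_one]
    refine ⟨⟨t.val - m, by omega⟩, ?_⟩
    ext b
    have : b ∈ (caterpillar m hm).neighborSet t ↔
      CaterpillarParent m t b ∨ CaterpillarParent m b t := Iff.rfl
    rw [this, Set.mem_singleton_iff, Fin.ext_iff]
    unfold CaterpillarParent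
    simp only
    omega

/-- Every set of at least two elements has a layout. -/
theorem nonempty_layout {U : Type*} [Finite U] (h : 2 ≤ Nat.card U) : Nonempty (Layout U) := by
  set m := Nat.card U with hm
  let g : Fin m → {t : Fin (2 * m) // ((caterpillar m h).neighborSet t).ncard = 1} := fun i =>
    ⟨⟨i.val + m, by omega⟩, (ncard_neighborSet_caterpillar_eq_one m h _).2 (by simp)⟩
  have hg : Function.Bijective g := by
    constructor
    · intro i j hij
      simpa [g, Fin.ext_iff] using hij
    · rintro ⟨t, ht⟩
      have ht' := (ncard_neighborSet_caterpillar_eq_one m h t).1 ht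
      exact ⟨⟨t.val - m, by omega⟩, by simp only [g, Subtype.mk.injEq, Fin.ext_iff]; omega⟩
  exact ⟨⟨2 * m, caterpillar m h, isTree_caterpillar m h, ncard_neighborSet_caterpillar_le m h,
    (Equiv.ofBijective g hg).symm.trans (Finite.equivFin U).symm⟩⟩

/-- Every set has a placement at the nodes of a subcubic tree whose width is at most the layout
width; this holds for sets with a single element, too. -/
theorem exists_placement {U : Type*} [Finite U] (f : Set U → ℕ) :
    ∃ (N : ℕ) (T : SimpleGraph (Fin N)) (p : U → Fin N), T.IsTree ∧
      (∀ t, (T.neighborSet t).ncard ≤ 3) ∧ Function.Injective p ∧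
      ∀ s t, T.Adj s t → f {e | (T.deleteEdges {s(s, t)}).Reachable t (p e)} ≤ layoutWidth f := by
  rcases le_or_gt 2 (Nat.card U) with h | h
  · have hne : {k | ∃ L : Layout U, ∀ s t, L.tree.Adj s t → f (L.side s t) ≤ k}.Nonempty := by
      obtain ⟨L⟩ := nonempty_layout h
      refine ⟨Finset.univ.sup fun x : Fin L.nodes × Fin L.nodes => f (L.side x.1 x.2), L,
        fun s t _ => ?_⟩
      exact Finset.le_sup (f := fun x : Fin L.nodes × Fin L.nodes => f (L.side x.1 x.2))
        (Finset.mem_univ (s, t))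
    obtain ⟨L, hL⟩ := Nat.sInf_mem hne
    exact ⟨L.nodes, L.tree, fun e => L.leafEquiv.symm e, L.isTree, L.degree_le,
      Subtype.val_injective.comp L.leafEquiv.symm.injective, hL⟩
  -- A single element has no layout, but a one-node tree carries it and has no edges to be bounded.
  · have : Subsingleton U := Finite.card_le_one_iff_subsingleton.1 (by omega)
    refine ⟨1, ⊥, fun _ => 0, IsTree.of_subsingleton, fun t => ?_, fun a b _ => Subsingleton.elim a b,
      fun s t h => absurd h (by simp)⟩
    refine (Set.ncard_le_card _).trans (by simp)

/-- If sources and sinks have degree at most one, then the tree-width is bounded in terms of the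
directed branch-width. This is stated for a digraph `H` that arises from `D` by splitting vertices
that are sources or sinks. -/
theorem treeWidth_le_directedBranchWidth (D : FinDigraph) {n : ℕ} (H : Digraph (Fin n))
    (ψ : Fin n → Fin D.1) (hψ : ∀ u v, H.Adj u v → D.2.Adj (ψ u) (ψ v))
    (hedge : ∀ u v u' v', H.Adj u v → H.Adj u' v' → ψ u = ψ u' → ψ v = ψ v' → u = u' ∧ v = v')
    (hinner : ∀ x, ∀ e f : Edge H, e ≠ f → (x = e.1.1 ∨ x = e.1.2) → (x = f.1.1 ∨ x = f.1.2) →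
      ¬ IsSource H x ∧ ¬ IsSink H x)
    (hinj : ∀ x y, ¬ IsSource H x → ¬ IsSink H x → ψ x = ψ y → x = y) :
    treeWidth H.toSimpleGraphInclusive ≤ 3 * directedBranchWidth D + 1 := by
  classical
  obtain ⟨N, T, p, hT, hdeg, hp, hwidth⟩ := exists_placement
    fun B : Set (Edge D.2) => (vertexSeparator D.2 B ∪ vertexSeparator D.2 Bᶜ).ncard
  let q : Edge H → Edge D.2 := fun e => ⟨(ψ e.1.1, ψ e.1.2), hψ _ _ e.2⟩
  have hq : Function.Injective q := by
    rintro ⟨⟨u, v⟩, h⟩ ⟨⟨u', v'⟩, h'⟩ hqq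
    simp only [q, Subtype.mk.injEq, Prod.mk.injEq] at hqq
    obtain ⟨rfl, rfl⟩ := hedge u v u' v' h h' hqq.1 hqq.2
    rfl
  refine treeWidth_le_of_placement (E := Edge H) _ (fun e => {e.1.1, e.1.2})
    (fun e => Finset.card_le_two) T hT hdeg (p ∘ q) (hp.comp hq) _ (fun s t hst => ?_) ?_
  · refine le_trans ?_ (hwidth s t hst)
    set B : Set (Edge D.2) := {e | (T.deleteEdges {s(s, t)}).Reachable t (p e)} with hB
    have hcut : ∀ x ∈ cutVertices (fun e : Edge H => ({e.1.1, e.1.2} : Finset (Fin n))) T (p ∘ q) s t,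
        (¬ IsSource H x ∧ ¬ IsSink H x) ∧ ψ x ∈ vertexSeparator D.2 B ∪ vertexSeparator D.2 Bᶜ := by
      rintro x ⟨e, f, he, hf, heB, hfB⟩
      rw [Finset.mem_insert, Finset.mem_singleton] at he hf
      have heB : q e ∉ B := heB
      have hfB : q f ∈ B := hfB
      have hin := hinner x e f (by rintro rfl; exact heB hfB) he hf
      refine ⟨hin, ?_⟩
      obtain ⟨u, hu⟩ : ∃ u, H.Adj u x := by simpa [IsSource] using hin.1
      obtain ⟨v, hv⟩ : ∃ v, H.Adj x v := by simpa [IsSink] using hin.2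
      have key₁ : ∀ g h : Edge H, x = g.1.2 → x = h.1.1 → q g ∉ B → q h ∈ B →
          ψ x ∈ vertexSeparator D.2 B ∪ vertexSeparator D.2 Bᶜ := fun g h hg hh hgB hhB =>
        Or.inl ⟨q g, q h, hgB, hhB, congrArg ψ hg.symm, congrArg ψ hh.symm⟩
      have key₂ : ∀ g h : Edge H, x = g.1.2 → x = h.1.1 → q g ∈ B → q h ∉ B →
          ψ x ∈ vertexSeparator D.2 B ∪ vertexSeparator D.2 Bᶜ := fun g h hg hh hgB hhB =>
        Or.inr ⟨q g, q h, not_not.2 hgB, hhB, congrArg ψ hg.symm, congrArg ψ hh.symm⟩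
      -- If `x` is the head of one edge and the tail of the other, these two witness the separator.
      -- If it is the tail of both, some edge enters `x`; whichever side that edge is on, it is
      -- opposite to `e` or `f`. Two heads are symmetric, with an edge leaving `x`.
      rcases he with he | he <;> rcases hf with hf | hf
      · by_cases hg : q ⟨(u, x), hu⟩ ∈ B
        · exact key₂ ⟨(u, x), hu⟩ e rfl he hg heB
        · exact key₁ ⟨(u, x), hu⟩ f rfl hf hg hfB
      · exact key₂ f e hf he hfB heB
      · exact key₁ e f he hf heB hfB
      · by_cases hg : q ⟨(x, v), hv⟩ ∈ B
        · exact key₁ e ⟨(x, v), hv⟩ he rfl heB hg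
        · exact key₂ f ⟨(x, v), hv⟩ hf rfl hfB hg
    exact Set.ncard_le_ncard_of_injOn ψ (fun x hx => (hcut x hx).2)
      (fun x hx y _ hxy => hinj x y (hcut x hx).1.1 (hcut x hx).1.2 hxy) (Set.toFinite _)
  · intro u v huv
    rw [Digraph.toSimpleGraphInclusive, SimpleGraph.fromRel_adj] at huv
    rcases huv.2 with h | h
    · exact ⟨⟨(u, v), h⟩, by simp, by simp⟩
    · exact ⟨⟨(v, u), h⟩, by simp, by simp⟩

/-! ### Splitting sources and sinks -/

/-- The edges `l` on the vertices below `c` arise from the edges `E` on the vertices below `n` by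
splitting; each new vertex `x` arose from `ψ x`. -/
structure IsSplitting (split : Bool → ℕ → Bool) (n : ℕ) (E l : List (ℕ × ℕ)) (c : ℕ) (ψ : ℕ → ℕ) :
    Prop where
  le : n ≤ c
  map_of_lt : ∀ x < n, ψ x = x
  map_edges : l.map (Prod.map ψ ψ) = E
  lt : ∀ x ∈ l, x.1 < c ∧ x.2 < c
  tail : ∀ x ∈ l, if x.1 < n then split false x.1 = false else split false (ψ x.1) = true
  head : ∀ x ∈ l, if x.2 < n then split true x.2 = false else split true (ψ x.2) = true
  -- With `unique`: every new vertex lies on exactly one edge.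
  incident : ∀ v, n ≤ v → v < c → ∃ x ∈ l, v = x.1 ∨ v = x.2
  unique : ∀ v, n ≤ v → ∀ x ∈ l, ∀ y ∈ l, (v = x.1 ∨ v = x.2) → (v = y.1 ∨ v = y.2) → x = y

/-- Induction on the edges: an additional edge introduces only vertices numbered from the current
counter on, so nothing known about the earlier edges changes. -/
theorem exists_isSplitting (split : Bool → ℕ → Bool) (n : ℕ) (E : List (ℕ × ℕ))
    (hE : ∀ x ∈ E, x.1 < n ∧ x.2 < n) :
    ∃ ψ, IsSplitting split n E (splitEdges split n E).1 (splitEdges split n E).2 ψ := by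
  induction E with
  | nil =>
    refine ⟨id, le_rfl, fun _ _ => rfl, rfl, ?_, ?_, ?_, ?_, ?_⟩ <;> simp [splitEdges]
  | cons x E ih =>
    obtain ⟨ψ, hψ⟩ := ih fun y hy => hE y (by simp [hy])
    obtain ⟨hx₁, hx₂⟩ := hE x (by simp)
    simp only [splitEdges]
    generalize (splitEdges split n E).1 = l at hψ ⊢
    generalize (splitEdges split n E).2 = c at hψ ⊢
    obtain ⟨le, map_of_lt, map_edges, lt, tail, head, incident, unique⟩ := hψ
    set y := freshen (split true x.2) x.2 c with hy
    set z := freshen (split false x.1) x.1 y.2 with hz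
    have hy' : (split true x.2 = true ∧ y.1 = c ∧ y.2 = c + 1) ∨
        (split true x.2 = false ∧ y.1 = x.2 ∧ y.2 = c) := by
      cases h : split true x.2 <;> simp [hy, freshen, h]
    have hz' : (split false x.1 = true ∧ z.1 = y.2 ∧ z.2 = y.2 + 1) ∨
        (split false x.1 = false ∧ z.1 = x.1 ∧ z.2 = y.2) := by
      cases h : split false x.1 <;> simp [hz, freshen, h]
    clear_value y z
    -- The head is served first: a number from `c` up to below `y.2` is the fresh head, and `y.2`
    -- itself, if used, is the fresh tail.
    let ψ' : ℕ → ℕ := fun a => if a < c then ψ a else if a < y.2 then x.2 else x.1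
    have hold : ∀ a < c, ψ' a = ψ a := fun a ha => if_pos ha
    have hz₁ : ψ' z.1 = x.1 := by
      rcases hz' with ⟨-, h, -⟩ | ⟨-, h, -⟩
      · have h₁ : ¬ z.1 < c := by omega
        have h₂ : ¬ z.1 < y.2 := by omega
        simp [ψ', h₁, h₂]
      · rw [h, hold _ (by omega), map_of_lt _ hx₁]
    have hy₁ : ψ' y.1 = x.2 := by
      rcases hy' with ⟨-, h, h'⟩ | ⟨-, h, -⟩
      · have h₁ : ¬ y.1 < c := by omega
        have h₂ : y.1 < y.2 := by omega
        simp [ψ', h₁, h₂]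
      · rw [h, hold _ (by omega), map_of_lt _ hx₂]
    refine ⟨ψ', by omega, fun a ha => ?_, ?_, ?_, ?_, ?_, ?_, ?_⟩
    · rw [hold a (by omega), map_of_lt a ha]
    · rw [List.map_cons, ← map_edges]
      congr 1
      · simp [hz₁, hy₁]
      · refine List.map_congr_left fun a ha => ?_
        simp [Prod.map, hold _ (lt a ha).1, hold _ (lt a ha).2]
    · intro a ha
      rcases List.mem_cons.1 ha with rfl | ha
      · simp only; omega
      · have := lt a ha; omega
    · intro a ha
      rcases List.mem_cons.1 ha with rfl | ha
      · simp only
        rw [hz₁]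
        rcases hz' with ⟨h, h', -⟩ | ⟨h, h', -⟩
        · rw [if_neg (by omega), h]
        · rw [h', if_pos hx₁, h]
      · rw [hold _ (lt a ha).1]; exact tail a ha
    · intro a ha
      rcases List.mem_cons.1 ha with rfl | ha
      · simp only
        rw [hy₁]
        rcases hy' with ⟨h, h', -⟩ | ⟨h, h', -⟩
        · rw [if_neg (by omega), h]
        · rw [h', if_pos hx₂, h]
      · rw [hold _ (lt a ha).2]; exact head a ha
    · intro v hv hvc
      by_cases h : v < c
      · obtain ⟨a, ha, hva⟩ := incident v hv h
        exact ⟨a, by simp [ha], hva⟩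
      · exact ⟨(z.1, y.1), by simp, by simp only; omega⟩
    · intro v hv a ha b hb hva hvb
      rcases List.mem_cons.1 ha with rfl | ha <;> rcases List.mem_cons.1 hb with rfl | hb
      · rfl
      · have := lt b hb; simp only at hva; omega
      · have := lt a ha; simp only at hvb; omega
      · exact unique v hv a ha b hb hva hvb

theorem needsSplit_true {E : List (ℕ × ℕ)} {a : ℕ} :
    needsSplit E true a = true ↔ ∀ b, (a, b) ∉ E := by
  simp only [needsSplit, if_true, Bool.not_eq_true', List.any_eq_false, decide_eq_true_eq]
  exact ⟨fun h b hb => h _ hb rfl, fun h x hx hxa => h x.2 (by rw [← hxa]; exact hx)⟩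

theorem needsSplit_false {E : List (ℕ × ℕ)} {a : ℕ} :
    needsSplit E false a = true ↔ ∀ b, (b, a) ∉ E := by
  simp only [needsSplit, Bool.false_eq_true, if_false, Bool.not_eq_true', List.any_eq_false,
    decide_eq_true_eq]
  exact ⟨fun h b hb => h _ hb rfl, fun h x hx hxa => h x.1 (by rw [← hxa]; exact hx)⟩

/-! ### Instances as lists of pairs of numbers -/

namespace Instance

variable {X : Type*}

/-- The edges of an instance as pairs of numbers. -/
def natEdges (I : Instance X) : List (ℕ × ℕ) :=
  I.edges.map (Prod.map Fin.val Fin.val)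

theorem mem_natEdges (I : Instance X) (u v : Fin I.n) :
    (u.val, v.val) ∈ I.natEdges ↔ I.digraph.2.Adj u v := by
  have hinj : Function.Injective (Prod.map Fin.val Fin.val : Fin I.n × Fin I.n → ℕ × ℕ) :=
    Fin.val_injective.prodMap Fin.val_injective
  exact List.mem_map_of_injective hinj (a := (u, v))

theorem lt_of_mem_natEdges (I : Instance X) : ∀ x ∈ I.natEdges, x.1 < I.n ∧ x.2 < I.n := by
  intro x hx
  obtain ⟨y, -, rfl⟩ := List.mem_map.1 hx
  exact ⟨y.1.2, y.2.2⟩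

theorem nodup_natEdges (I : Instance X) : I.natEdges.Nodup :=
  I.nodup.map (Fin.val_injective.prodMap Fin.val_injective)

theorem encode_eq (bits : X → List Bool) (I : Instance X) :
    I.encode bits =
      encodeNat I.n ++ encodeEdges I.natEdges ++ [Sym.endGraph] ++ (bits I.extra).map Sym.bit := by
  simp [encode, encodeEdges, natEdges, List.flatMap_map]

theorem exists_natEdges_eq (n : ℕ) (l : List (ℕ × ℕ)) (hl : l.Nodup)
    (hn : ∀ x ∈ l, x.1 < n ∧ x.2 < n) (a : X) :
    ∃ J : Instance X, J.n = n ∧ J.natEdges = l ∧ J.extra = a := by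
  have : ∃ l' : List (Fin n × Fin n), l'.map (Prod.map Fin.val Fin.val) = l := by
    clear hl
    induction l with
    | nil => exact ⟨[], rfl⟩
    | cons x l ih =>
      obtain ⟨l', rfl⟩ := ih fun y hy => hn y (by simp [hy])
      have hx := hn x (by simp)
      exact ⟨(⟨x.1, hx.1⟩, ⟨x.2, hx.2⟩) :: l', rfl⟩
  obtain ⟨l', rfl⟩ := this
  exact ⟨⟨n, l', hl.of_map, a⟩, rfl, rfl, rfl⟩

theorem digraph_congr {I J : Instance X} (hn : I.n = J.n) (h : I.natEdges = J.natEdges) :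
    I.digraph = J.digraph := by
  obtain ⟨n, l, hl, a⟩ := I
  obtain ⟨m, l', hl', b⟩ := J
  obtain rfl : n = m := hn
  have : l = l' := List.map_injective_iff.2 (Fin.val_injective.prodMap Fin.val_injective) h
  subst this
  rfl

end Instance

/-! ### The digraphs before and after splitting -/

section Splitting

variable {X : Type*} {I J : Instance X} {ψ : ℕ → ℕ}

theorem IsSplitting.map_lt
    (h : IsSplitting (needsSplit I.natEdges) I.n I.natEdges J.natEdges J.n ψ) (x : Fin J.n) :
    ψ x < I.n := by
  by_cases hx : x.val < I.n
  · rw [h.map_of_lt _ hx]; exact hx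
  · obtain ⟨e, he, hxe⟩ := h.incident x (by omega) x.2
    have := I.lt_of_mem_natEdges (ψ e.1, ψ e.2) (by
      rw [← h.map_edges]; exact List.mem_map_of_mem (f := Prod.map ψ ψ) he)
    rcases hxe with hxe | hxe <;> rw [hxe]
    exacts [this.1, this.2]

/-- The map from the vertices of the digraph after splitting to those before. -/
def IsSplitting.vertexMap
    (h : IsSplitting (needsSplit I.natEdges) I.n I.natEdges J.natEdges J.n ψ) (x : Fin J.n) :
    Fin I.n :=
  ⟨ψ x, h.map_lt x⟩

variable (h : IsSplitting (needsSplit I.natEdges) I.n I.natEdges J.natEdges J.n ψ)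

include h in
theorem IsSplitting.mem_iff (a b : ℕ) :
    (a, b) ∈ I.natEdges ↔ ∃ x ∈ J.natEdges, ψ x.1 = a ∧ ψ x.2 = b := by
  conv_lhs => rw [← h.map_edges]
  simp [List.mem_map, Prod.ext_iff]

theorem IsSplitting.surjective : Function.Surjective h.vertexMap := fun y =>
  ⟨⟨y, y.2.trans_le h.le⟩, Fin.ext (h.map_of_lt _ y.2)⟩

theorem IsSplitting.adj_iff (p q : Fin I.n) :
    I.digraph.2.Adj p q ↔ ∃ u v, h.vertexMap u = p ∧ h.vertexMap v = q ∧ J.digraph.2.Adj u v := by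
  rw [← I.mem_natEdges, h.mem_iff]
  constructor
  · rintro ⟨x, hx, h₁, h₂⟩
    have hlt := h.lt x hx
    exact ⟨⟨x.1, hlt.1⟩, ⟨x.2, hlt.2⟩, Fin.ext h₁, Fin.ext h₂, (J.mem_natEdges _ _).1 hx⟩
  · rintro ⟨u, v, rfl, rfl, huv⟩
    exact ⟨_, (J.mem_natEdges u v).2 huv, rfl, rfl⟩

theorem IsSplitting.isSource_or_isSink_of_le {x : Fin J.n} (hx : I.n ≤ x) :
    IsSource I.digraph.2 (h.vertexMap x) ∨ IsSink I.digraph.2 (h.vertexMap x) := by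
  obtain ⟨e, he, hxe⟩ := h.incident x hx x.2
  refine hxe.imp (fun hxe u hu => ?_) fun hxe u hu => ?_
  · have := h.tail e he
    rw [if_neg (by omega), ← hxe, needsSplit_false] at this
    exact this u ((I.mem_natEdges u _).2 hu)
  · have := h.head e he
    rw [if_neg (by omega), ← hxe, needsSplit_true] at this
    exact this u ((I.mem_natEdges _ u).2 hu)

/-- The projection fixes the old vertices, so of two vertices with the same image one is new, and
new vertices arise only from sources and sinks. -/
theorem IsSplitting.isSource_or_isSink {x y : Fin J.n} (hxy : h.vertexMap x = h.vertexMap y)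
    (hne : x ≠ y) : IsSource I.digraph.2 (h.vertexMap x) ∨ IsSink I.digraph.2 (h.vertexMap x) := by
  by_cases hx : I.n ≤ x
  · exact h.isSource_or_isSink_of_le hx
  · by_cases hy : I.n ≤ y
    · rw [hxy]; exact h.isSource_or_isSink_of_le hy
    · have := congrArg Fin.val hxy
      simp only [vertexMap] at this
      rw [h.map_of_lt _ (by omega), h.map_of_lt _ (by omega)] at this
      exact absurd (Fin.ext this) hne

include h in
/-- A source-sink-invariant problem has the same answer before and after splitting. -/
theorem IsSplitting.iff {P : DigraphProblem X} (hP : SourceSinkInvariant P) (a : X) :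
    P J.digraph a ↔ P I.digraph a := by
  -- Without new vertices the instance has not changed. Otherwise the projection cannot be
  -- injective, as `equivalent_of_quotient` demands.
  by_cases hn : J.n = I.n
  · have : J.natEdges = I.natEdges := by
      conv_rhs => rw [← h.map_edges]
      refine (List.map_id _).symm.trans (List.map_congr_left fun x hx => ?_)
      have := h.lt x hx
      simp [Prod.map, h.map_of_lt x.1 (by omega), h.map_of_lt x.2 (by omega)]
    rw [Instance.digraph_congr hn this]
  · refine hP _ _ (equivalent_of_quotient _ I.digraph h.vertexMap h.surjective h.adj_iff
      (fun x y => h.isSource_or_isSink) fun hinj => ?_) a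
    have := Fintype.card_le_of_injective _ hinj
    have hle := h.le
    have hcard : Fintype.card (Fin J.n) ≤ Fintype.card (Fin I.n) := this
    rw [Fintype.card_fin, Fintype.card_fin] at hcard
    omega

include h in
/-- After splitting, the tree-width is bounded in terms of the directed branch-width. -/
theorem IsSplitting.underlyingTreeWidth_le :
    underlyingTreeWidth J.digraph ≤ 3 * directedBranchWidth I.digraph + 1 := by
  have hhom : ∀ u v, J.digraph.2.Adj u v → I.digraph.2.Adj (h.vertexMap u) (h.vertexMap v) :=
    fun u v huv => (h.adj_iff _ _).2 ⟨u, v, rfl, rfl, huv⟩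
  refine treeWidth_le_directedBranchWidth I.digraph J.digraph.2 h.vertexMap hhom ?_ ?_ ?_
  · intro u v u' v' huv huv' hu hv
    have hnd := I.nodup_natEdges
    rw [← h.map_edges] at hnd
    have := List.inj_on_of_nodup_map hnd ((J.mem_natEdges u v).2 huv) ((J.mem_natEdges u' v').2 huv')
      (Prod.ext (congrArg Fin.val hu) (congrArg Fin.val hv))
    rw [Prod.mk.injEq] at this
    exact ⟨Fin.ext this.1, Fin.ext this.2⟩
  · rintro x ⟨⟨u, v⟩, huv⟩ ⟨⟨u', v'⟩, huv'⟩ hne hx hx'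
    have he := (J.mem_natEdges u v).2 huv
    -- A new vertex lies on one edge only, so `x` is old.
    have hlt : x.val < I.n := by
      by_contra hx₀
      have := h.unique x (by omega) _ he _ ((J.mem_natEdges u' v').2 huv')
        (hx.imp (congrArg Fin.val) (congrArg Fin.val))
        (hx'.imp (congrArg Fin.val) (congrArg Fin.val))
      rw [Prod.mk.injEq] at this
      exact hne (Subtype.ext (Prod.ext (Fin.ext this.1) (Fin.ext this.2)))
    have hIe := (h.mem_iff _ _).2 ⟨_, he, rfl, rfl⟩
    rcases hx with hx | hx
    · obtain rfl : x = u := hx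
      refine ⟨fun hsrc => ?_, fun hsink => hsink v huv⟩
      -- The old tail was kept, so some edge of the original digraph enters `x`. Its copy still ends
      -- at `x`: a fresh head would make `x` a sink of the original digraph, although an edge leaves
      -- it there.
      have h₁ := h.tail _ he
      rw [if_pos hlt, ← Bool.not_eq_true, needsSplit_false] at h₁
      push Not at h₁
      obtain ⟨b, hb⟩ := h₁
      obtain ⟨⟨g₁, g₂⟩, hg, -, hg₂⟩ := (h.mem_iff _ _).1 hb
      have h₂ := h.head _ hg
      split_ifs at h₂ with hg'
      · have : g₂ = x := (h.map_of_lt _ hg').symm.trans hg₂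
        subst this
        exact hsrc ⟨g₁, (h.lt _ hg).1⟩ ((J.mem_natEdges _ _).1 hg)
      · rw [hg₂, needsSplit_true] at h₂
        simp only [h.map_of_lt _ hlt] at hIe
        exact h₂ _ hIe
    · obtain rfl : x = v := hx
      refine ⟨fun hsrc => hsrc u huv, fun hsink => ?_⟩
      have h₁ := h.head _ he
      rw [if_pos hlt, ← Bool.not_eq_true, needsSplit_true] at h₁
      push Not at h₁
      obtain ⟨b, hb⟩ := h₁
      obtain ⟨⟨g₁, g₂⟩, hg, hg₁, -⟩ := (h.mem_iff _ _).1 hb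
      have h₂ := h.tail _ hg
      split_ifs at h₂ with hg'
      · have : g₁ = x := (h.map_of_lt _ hg').symm.trans hg₁
        subst this
        exact hsink ⟨g₂, (h.lt _ hg).2⟩ ((J.mem_natEdges _ _).1 hg)
      · rw [hg₁, needsSplit_false] at h₂
        simp only [h.map_of_lt _ hlt] at hIe
        exact h₂ _ hIe
  · intro x y hsrc hsink hxy
    by_contra hne
    rcases h.isSource_or_isSink hxy hne with hs | hs
    · exact hsrc fun u hu => hs _ (hhom _ _ hu)
    · exact hsink fun u hu => hs _ (hhom _ _ hu)

end Splitting

/-! ### The theorem -/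

/-- Partial sums dominate every earlier value of `f`, which replaces monotonicity when only an upper
bound on the tree-width is known. -/
theorem computable_sum_range {f : ℕ → ℕ} (hf : Computable f) :
    Computable fun n => ∑ j ∈ Finset.range n, f j := by
  have hstep : Computable₂ fun (_ : ℕ) (p : ℕ × ℕ) => p.2 + f p.1 :=
    (Primrec.nat_add.to_comp).comp (Computable.snd.comp Computable.snd)
      (hf.comp (Computable.fst.comp Computable.snd))
  refine (Computable.nat_rec Computable.id (Computable.const 0) hstep).of_eq fun n => ?_
  induction n with
  | zero => rfl
  | succ n ih =>
    rw [Finset.sum_range_succ, ← ih]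
    rfl

theorem length_encodeEdges_le (l : List (ℕ × ℕ)) (c : ℕ) (hl : ∀ x ∈ l, x.1 < c ∧ x.2 < c) :
    (encodeEdges l).length ≤ 2 * l.length * c := by
  induction l with
  | nil => simp
  | cons x l ih =>
    have h₁ := ih fun y hy => hl y (by simp [hy])
    have h₂ := hl x (by simp)
    simp only [encodeEdges_cons, List.length_append, length_encodeNat, List.length_cons]
    have : 2 * (l.length + 1) * c = 2 * l.length * c + 2 * c := by ring
    omega

end DirectedBranchWidth

open DirectedBranchWidth in
theorem mainTheorem9 {X : Type*} (bits : X → List Bool)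
    (P : DirectedBranchWidth.DigraphProblem X)
    (hP : DirectedBranchWidth.SourceSinkInvariant P)
    (htw : DirectedBranchWidth.FPTParameterizedBy bits P
      DirectedBranchWidth.underlyingTreeWidth) :
    DirectedBranchWidth.FPTParameterizedBy bits P
      DirectedBranchWidth.directedBranchWidth := by
  obtain ⟨M, f, c, hf, hM⟩ := htw
  -- The range includes `3 * k + 1`, the bound on the tree-width. The summand `1` pays for
  -- splitting; `3 * c` comes from the cubic growth of the word, and `7` from `30 * L ^ 2 ≤ L ^ 7`
  -- for `2 ≤ L`.
  refine ⟨splitComputableAux M, fun k => (∑ j ∈ Finset.range (3 * k + 2), f j) + 1, 3 * c + 7,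
    ?_, fun I => ?_⟩
  · have h₁ : Computable fun k : ℕ => 3 * k + 2 :=
      (Primrec.nat_add.comp (Primrec.nat_mul.comp (Primrec.const 3) Primrec.id)
        (Primrec.const 2)).to_comp
    exact Computable.succ.comp ((computable_sum_range hf).comp h₁)
  · obtain ⟨ψ, hψ⟩ := exists_isSplitting (needsSplit I.natEdges) I.n I.natEdges I.lt_of_mem_natEdges
    have hsize := splitEdges_snd_le (needsSplit I.natEdges) I.n I.natEdges
    have hnd : (splitEdges (needsSplit I.natEdges) I.n I.natEdges).1.Nodup :=
      List.Nodup.of_map (Prod.map ψ ψ) (by rw [hψ.map_edges]; exact I.nodup_natEdges)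
    obtain ⟨J, hJn, hJe, hJa⟩ := Instance.exists_natEdges_eq _ _ hnd hψ.lt I.extra
    obtain ⟨answer, hans, hrun⟩ := hM J
    have hrun' : Nonempty (Turing.TM2OutputsInTime M.tm
        ((J.encode bits).map M.inputAlphabet.symm) (some ([answer].map M.outputAlphabet.symm))
        (f (underlyingTreeWidth J.digraph) * (J.encode bits).length ^ c)) := hrun
    set L' := (J.encode bits).length with hL'
    rw [J.encode_eq, hJn, hJe, hJa] at hrun'
    have hfin := splitComputableAux_outputs M I.lt_of_mem_natEdges _ answer hrun'
    rw [← I.encode_eq bits] at hfin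
    set L := (I.encode bits).length with hL
    have hlen : (splitEdges (needsSplit I.natEdges) I.n I.natEdges).1.length = I.natEdges.length := by
      conv_rhs => rw [← hψ.map_edges]
      simp
    rw [← hJn, ← hJe] at hψ
    have hLval : L = I.n + 1 + (encodeEdges I.natEdges).length + 1 + (bits I.extra).length := by
      rw [hL, I.encode_eq]; simp; omega
    have hL'val : L' = J.n + 1 + (encodeEdges J.natEdges).length + 1 + (bits J.extra).length := by
      rw [hL', J.encode_eq]; simp; omega
    -- There are as many edges as before, with both `2 * |E|` and the new order at most `L`; so the
    -- new edge word has length at most `L ^ 2`.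
    have hcube : L' ≤ L ^ 3 := by
      have h₁ := length_encodeEdges_le J.natEdges J.n J.lt_of_mem_natEdges
      have h₂ := two_mul_length_le I.natEdges
      rw [hJe, hlen, ← hJe] at h₁
      rw [hJa] at hL'val
      rw [← hJn] at hsize
      have h₃ : 2 * I.natEdges.length * J.n ≤ L * L := Nat.mul_le_mul (by omega) (by omega)
      have h₄ : L ≤ L * L := Nat.le_mul_self L
      have h₅ : 2 * (L * L) ≤ L * (L * L) := Nat.mul_le_mul_right _ (by omega)
      have h₆ : L ^ 3 = L * (L * L) := by ring
      omega
    refine ⟨answer, ?_, ?_⟩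
    · have hans' : answer = true ↔ P J.digraph J.extra := hans
      rw [hans', hJa]
      exact hψ.iff hP I.extra
    · refine hfin.elim fun o => ⟨⟨o.toEvalsTo, o.steps_le_m.trans ?_⟩⟩
      have hL2 : 2 ≤ L := by omega
      have h₁ : f (underlyingTreeWidth J.digraph) ≤
          ∑ j ∈ Finset.range (3 * directedBranchWidth I.digraph + 2), f j :=
        Finset.single_le_sum (f := f) (fun _ _ => Nat.zero_le _)
          (Finset.mem_range.2 (by have := hψ.underlyingTreeWidth_le; omega))
      have h₂ : L' ^ c ≤ L ^ (3 * c + 7) :=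
        (Nat.pow_le_pow_left hcube c).trans
          (by rw [← pow_mul]; exact Nat.pow_le_pow_right (by omega) (by omega))
      have h₃ : 30 * L ^ 2 ≤ L ^ (3 * c + 7) := by
        have h₄ : 2 ^ 5 ≤ L ^ 5 := Nat.pow_le_pow_left hL2 5
        calc 30 * L ^ 2 ≤ L ^ 5 * L ^ 2 := Nat.mul_le_mul_right _ (by omega)
          _ = L ^ 7 := by ring
          _ ≤ L ^ (3 * c + 7) := Nat.pow_le_pow_right (by omega) (by omega)
      have h₄ := Nat.mul_le_mul h₁ h₂
      simp only
      rw [Nat.add_mul, Nat.one_mul]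
      omega
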